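/- For a finite simple graph $H$ and a positive integer $k$, consider proper colorings of $H$ with color classes $V_1\uplus\dots\uplus V_k=V(H)$. Such a coloring is a $b$-coloring of order $k$ if for every $i\in\{1,\dots,k\}$ there is $v_i\in V_i$ that has a neighbor in every $V_j$ with $j\neq i$; it is a partial Grundy coloring of order $k$ if for every $i\in\{1,\dots,k\}$ there is $v_i\in V_i$ that has a neighbor in every $V_j$ with $j<i$. A graph $G$ has a $k$-witness for $b$-Chromatic Core (respectively, for Partial Grundy Coloring) if there is a set $S\subseteq V(G)$ such that the induced subgraph $G[S]$ admits a $b$-coloring (respectively, a partial Grundy coloring) of order $k$. **Theorem.** For each of the two problems there are a deterministic algorithm (a program of a unit-cost random access machine with addition and subtraction), a computable function $f:\mathbb N\to\mathbb N$ and a constant $c$ such that the following holds. Given a positive integer $k$, non-negative integers $d$ and $s$, and a graph $G$ on $n$ vertices (by its adjacency matrix) in which at most $s$ vertices have degree larger than $d$, the algorithm correctly decides within $f(k+d+s)\cdot (n+1)^{c}$ steps whether $G$ has a $k$-witness for $b$-Chromatic Core (respectively, for Partial Grundy Coloring). That is, both problems can be decided in FPT time parameterized by $k+d+s$ on such graphs.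 -/

import Mathlib

/-! ### Random access machine with unit-cost steps -/

namespace RAM

/-- Programs of a random access machine. Registers and arrays are named by constants that stand in
the program text, so every program uses finitely many of both. The arithmetic operations are
addition and truncated subtraction only (no multiplication), so that the unit-cost measure is
polynomially related to Turing machine time. -/
inductive Prog : Type
  /-- `reg r := c` -/
  | const (r c : ℕ)
  /-- `reg r := reg a` -/
  | copy (r a : ℕ)
  /-- `reg r := reg a + reg b` -/
  | add (r a b : ℕ)
  /-- `reg r := max (reg a - reg b) 0` -/
  | sub (r a b : ℕ)
  /-- `reg r := mem A [reg a]` -/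
  | load (r A a : ℕ)
  /-- `mem A [reg a] := reg b` -/
  | store (A a b : ℕ)
  /-- first `p`, then `q` -/
  | seq (p q : Prog)
  /-- `p` if `reg r ≠ 0`, and `q` otherwise -/
  | ifNZ (r : ℕ) (p q : Prog)
  /-- repeat `p` as long as `reg r ≠ 0` -/
  | whileNZ (r : ℕ) (p : Prog)

/-- The contents of the registers and of the arrays. -/
structure State : Type where
  reg : ℕ → ℕ
  mem : ℕ → ℕ → ℕ

/-- Write `x` to register `r`. -/
def State.setReg (σ : State) (r x : ℕ) : State :=
  { σ with reg := Function.update σ.reg r x }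

/-- Write `x` to cell `i` of array `A`. -/
def State.setMem (σ : State) (A i x : ℕ) : State :=
  { σ with mem := Function.update σ.mem A (Function.update (σ.mem A) i x) }

/-- `Exec p σ t τ`: started in `σ`, the program `p` halts after exactly `t` steps in `τ`.
Each elementary instruction and each evaluation of a test is one step. -/
inductive Exec : Prog → State → ℕ → State → Prop
  | const (r c : ℕ) (σ : State) : Exec (.const r c) σ 1 (σ.setReg r c)
  | copy (r a : ℕ) (σ : State) : Exec (.copy r a) σ 1 (σ.setReg r (σ.reg a))
  | add (r a b : ℕ) (σ : State) : Exec (.add r a b) σ 1 (σ.setReg r (σ.reg a + σ.reg b))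
  | sub (r a b : ℕ) (σ : State) : Exec (.sub r a b) σ 1 (σ.setReg r (σ.reg a - σ.reg b))
  | load (r A a : ℕ) (σ : State) : Exec (.load r A a) σ 1 (σ.setReg r (σ.mem A (σ.reg a)))
  | store (A a b : ℕ) (σ : State) :
      Exec (.store A a b) σ 1 (σ.setMem A (σ.reg a) (σ.reg b))
  | seq {p q : Prog} {σ τ υ : State} {t u : ℕ} (hp : Exec p σ t τ) (hq : Exec q τ u υ) :
      Exec (.seq p q) σ (t + u) υ
  | ifNZ_true {r : ℕ} {p q : Prog} {σ τ : State} {t : ℕ} (h : σ.reg r ≠ 0)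
      (hp : Exec p σ t τ) : Exec (.ifNZ r p q) σ (t + 1) τ
  | ifNZ_false {r : ℕ} {p q : Prog} {σ τ : State} {t : ℕ} (h : σ.reg r = 0)
      (hq : Exec q σ t τ) : Exec (.ifNZ r p q) σ (t + 1) τ
  | whileNZ_stop {r : ℕ} {p : Prog} {σ : State} (h : σ.reg r = 0) :
      Exec (.whileNZ r p) σ 1 σ
  | whileNZ_step {r : ℕ} {p : Prog} {σ τ υ : State} {t u : ℕ} (h : σ.reg r ≠ 0)
      (hp : Exec p σ t τ) (hw : Exec (.whileNZ r p) τ u υ) :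
      Exec (.whileNZ r p) σ (t + u + 1) υ

/-- The machine is deterministic: the running time and the result of a halting run are unique. -/
theorem Exec.unique {p : Prog} {σ τ τ' : State} {t t' : ℕ} (h : Exec p σ t τ)
    (h' : Exec p σ t' τ') : t = t' ∧ τ = τ' := by
  induction h generalizing t' τ' with
  | const | copy | add | sub | load | store => cases h'; exact ⟨rfl, rfl⟩
  | seq _ _ ih₁ ih₂ =>
    cases h' with
    | seq a b =>
      obtain ⟨rfl, rfl⟩ := ih₁ a
      obtain ⟨rfl, rfl⟩ := ih₂ b
      exact ⟨rfl, rfl⟩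
  | ifNZ_true h _ ih =>
    cases h' with
    | ifNZ_true _ a =>
      obtain ⟨rfl, rfl⟩ := ih a
      exact ⟨rfl, rfl⟩
    | ifNZ_false h₀ _ => exact absurd h₀ h
  | ifNZ_false h _ ih =>
    cases h' with
    | ifNZ_true h₀ _ => exact absurd h h₀
    | ifNZ_false _ a =>
      obtain ⟨rfl, rfl⟩ := ih a
      exact ⟨rfl, rfl⟩
  | whileNZ_stop h =>
    cases h' with
    | whileNZ_stop _ => exact ⟨rfl, rfl⟩
    | whileNZ_step h₀ _ _ => exact absurd h h₀
  | whileNZ_step h _ _ ih₁ ih₂ =>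
    cases h' with
    | whileNZ_stop h₀ => exact absurd h₀ h
    | whileNZ_step _ a b =>
      obtain ⟨rfl, rfl⟩ := ih₁ a
      obtain ⟨rfl, rfl⟩ := ih₂ b
      exact ⟨rfl, rfl⟩

end RAM

/-! ### Colorings and witnesses -/

namespace SimpleGraph

variable {V : Type*}

/-- A proper coloring with color classes indexed by `Fin k` (color `i` of `Fin k` is the color
`i + 1` of `{1, …, k}`) is a partial Grundy coloring of order `k` if every class contains a vertex
that has a neighbor in every class of smaller index. -/
def IsPartialGrundyColoring (G : SimpleGraph V) {k : ℕ} (c : G.Coloring (Fin k)) : Prop :=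
  ∀ i : Fin k, ∃ v : V, c v = i ∧ ∀ j : Fin k, j < i → ∃ w : V, G.Adj v w ∧ c w = j

/-- A proper coloring with color classes indexed by `Fin k` is a `b`-coloring of order `k` if
every class contains a vertex that has a neighbor in every other class. -/
def IsBColoring (G : SimpleGraph V) {k : ℕ} (c : G.Coloring (Fin k)) : Prop :=
  ∀ i : Fin k, ∃ v : V, c v = i ∧ ∀ j : Fin k, j ≠ i → ∃ w : V, G.Adj v w ∧ c w = j

/-- `G[S]` is a `k`-witness for Partial Grundy Coloring. -/
def IsPartialGrundyWitness (G : SimpleGraph V) (k : ℕ) (S : Set V) : Prop :=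
  ∃ c : (G.induce S).Coloring (Fin k), (G.induce S).IsPartialGrundyColoring c

/-- `G[S]` is a `k`-witness for `b`-Chromatic Core, that is, `S` is a `b`-chromatic core of
order `k`. -/
def IsBChromaticCore (G : SimpleGraph V) (k : ℕ) (S : Set V) : Prop :=
  ∃ c : (G.induce S).Coloring (Fin k), (G.induce S).IsBColoring c

open Classical in
/-- At most `s` vertices of `G` have degree larger than `d`. -/
def AlmostBoundedDegree [Fintype V] (G : SimpleGraph V) (d s : ℕ) : Prop :=
  {v : V | d < G.degree v}.ncard ≤ s

end SimpleGraph

/-! ### Deciding graph problems in FPT time -/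

/-- An input: a graph with vertices `0, …, n - 1` and the integers `k`, `d`, `s`. -/
structure GraphInstance : Type where
  n : ℕ
  G : SimpleGraph (Fin n)
  k : ℕ
  d : ℕ
  s : ℕ

namespace GraphInstance

open Classical in
/-- The initial state of the machine: registers `0, 1, 2, 3` hold `n, k, d, s`, array `0` holds
the adjacency matrix row by row, and everything else is `0`. -/
noncomputable def initState (I : GraphInstance) : RAM.State where
  reg r := if r = 0 then I.n else if r = 1 then I.k else if r = 2 then I.d
    else if r = 3 then I.s else 0
  mem A x := if A = 0 ∧ ∃ i j : Fin I.n, x = (i : ℕ) * I.n + (j : ℕ) ∧ I.G.Adj i j then 1 else 0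

end GraphInstance

open Classical in
/-- The question `Q` can be decided in FPT time with parameter `κ` on the instances that satisfy
`P`: a single program halts on each of them within `f (κ I) * n ^ O(1)` steps, for a computable
function `f`, with the correct answer (`1` for yes, `0` for no) in register `0`.
The base `n + 1` only serves to avoid the degenerate bound `0` for the graph without vertices. -/
def DecidableInFPTTime (P : GraphInstance → Prop) (κ : GraphInstance → ℕ)
    (Q : GraphInstance → Prop) : Prop :=
  ∃ (p : RAM.Prog) (f : ℕ → ℕ) (c : ℕ), Computable f ∧
    ∀ I : GraphInstance, P I →
      ∃ (t : ℕ) (τ : RAM.State), RAM.Exec p I.initState t τ ∧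
        t ≤ f (κ I) * (I.n + 1) ^ c ∧ τ.reg 0 = if Q I then 1 else 0

/-! A witness of order `k` can be thinned out to `k` rows of `k` slots. Row `i` holds a vertex of
color `i`, its center, and a neighbor of color `j` of the center for every `j` with `R i j`, where
`R i j` is `¬j = i` for b-colorings and `j < i` for partial Grundy colorings. A witness exists iff
the `k * k` slots can be filled subject to pairwise conditions (`IsSolution`).

The search guesses a mode for every slot: one of the at most `s` vertices of degree larger than `d`
(hubs), the neighbor of given rank of the center of its row, or free. Once the vertices of the free
slots, the roots, are chosen, every slot is determined. The candidates for a root are the vertices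
whose group of dependent slots is consistent in itself and with the hubs (`valid`), so only
conflicts between the groups of different roots remain. Two groups conflict only if their roots are
joined by a walk of length at most three through vertices of degree at most `d`
(`Describes.mem_near`), so a fixed choice for one root rules out at most `(d + 1) ^ 3` candidates
for another. By the exchange argument `exists_choice`, a root of a solution that is not among its
first `k * k * (d + 1) ^ 3 + 1` candidates can be replaced by one of them without conflict. Hence it
suffices to try that many ranks per slot, and the number of trials depends on `k`, `d`, `s` only.
Each trial is checked in full, so acceptance is always correct.

The running time is handled by a calculus: `Comp` is closed under addition, subtraction, array
access, branching and bounded iteration (`Comp.iter`), hence under bounded sums and quantifiers. The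
acceptance condition is a formula of this kind, and its program and time bound follow its syntax. -/

/-! ### Functions that are computable in FPT time -/

namespace RAM

/-- The parameter of an instance. -/
def param (I : GraphInstance) : ℕ := I.k + I.d + I.s

/-- A context: a type of environments, each of which belongs to an instance, together with
the variables whose values are available in registers. -/
structure Ctx where
  Env : Type
  inst : Env → GraphInstance
  vars : Set (Env → ℕ)

/-- `F` is bounded by `f (κ) * (n + 1) ^ c` for a computable `f`. -/
def FPTBounded (C : Ctx) (F : C.Env → ℕ) : Prop :=
  ∃ (f : ℕ → ℕ) (c : ℕ), Computable f ∧
    ∀ γ, F γ ≤ f (param (C.inst γ)) * ((C.inst γ).n + 1) ^ c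

theorem computable_add {f g : ℕ → ℕ} (hf : Computable f) (hg : Computable g) :
    Computable fun x => f x + g x :=
  Primrec.nat_add.to_comp.comp hf hg

theorem computable_mul {f g : ℕ → ℕ} (hf : Computable f) (hg : Computable g) :
    Computable fun x => f x * g x :=
  Primrec.nat_mul.to_comp.comp hf hg

theorem computable_pow {f g : ℕ → ℕ} (hf : Computable f) (hg : Computable g) :
    Computable fun x => f x ^ g x :=
  Computable₂.comp (f := fun a b : ℕ => a ^ b) (Primrec₂.unpaired'.1 Nat.Primrec.pow).to_comp hf hg

namespace FPTBounded

variable {C : Ctx} {F G : C.Env → ℕ}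

theorem mono (hG : FPTBounded C G) (h : ∀ γ, F γ ≤ G γ) : FPTBounded C F := by
  obtain ⟨f, c, hf, hb⟩ := hG
  exact ⟨f, c, hf, fun γ => (h γ).trans (hb γ)⟩

theorem of_param {f : ℕ → ℕ} (hf : Computable f) (h : ∀ γ, F γ ≤ f (param (C.inst γ))) :
    FPTBounded C F :=
  ⟨f, 0, hf, fun γ => by simpa using h γ⟩

theorem const (m : ℕ) : FPTBounded C fun _ => m :=
  of_param (f := fun _ => m) (Computable.const m) fun _ => le_rfl

theorem add (hF : FPTBounded C F) (hG : FPTBounded C G) : FPTBounded C fun γ => F γ + G γ := by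
  obtain ⟨f, c, hf, hb⟩ := hF
  obtain ⟨g, e, hg, hb'⟩ := hG
  refine ⟨fun x => f x + g x, c + e, computable_add hf hg, fun γ => ?_⟩
  rw [add_mul]
  refine add_le_add ((hb γ).trans ?_) ((hb' γ).trans ?_)
  · exact Nat.mul_le_mul_left _ (Nat.pow_le_pow_right (Nat.succ_pos _) (Nat.le_add_right _ _))
  · exact Nat.mul_le_mul_left _ (Nat.pow_le_pow_right (Nat.succ_pos _) (Nat.le_add_left _ _))

theorem mul (hF : FPTBounded C F) (hG : FPTBounded C G) : FPTBounded C fun γ => F γ * G γ := by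
  obtain ⟨f, c, hf, hb⟩ := hF
  obtain ⟨g, e, hg, hb'⟩ := hG
  refine ⟨fun x => f x * g x, c + e, computable_mul hf hg, fun γ => ?_⟩
  calc F γ * G γ ≤ _ := Nat.mul_le_mul (hb γ) (hb' γ)
    _ = _ := by ring

end FPTBounded

/-- The context extended by a loop index `i < N` and by the current value `A i` of an
accumulator. -/
def Ctx.loop (C : Ctx) (N : C.Env → ℕ) (A : C.Env → ℕ → ℕ) : Ctx where
  Env := Σ γ : C.Env, Fin (N γ)
  inst x := C.inst x.1
  vars := {g | (∃ v ∈ C.vars, g = fun x => v x.1) ∨ g = (fun x => (x.2 : ℕ)) ∨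
    g = fun x => A x.1 x.2}

/-- The context extended by a loop index `i < N`. -/
def Ctx.ext (C : Ctx) (N : C.Env → ℕ) : Ctx where
  Env := Σ γ : C.Env, Fin (N γ)
  inst x := C.inst x.1
  vars := {g | (∃ v ∈ C.vars, g = fun x => v x.1) ∨ g = fun x => (x.2 : ℕ)}

theorem FPTBounded.sum {C : Ctx} {N : C.Env → ℕ} {F : C.Env → ℕ → ℕ} (hN : FPTBounded C N)
    (hF : FPTBounded (C.ext N) fun x => F x.1 x.2) :
    FPTBounded C fun γ => ∑ i ∈ Finset.range (N γ), F γ i := by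
  obtain ⟨f, c, hf, hb⟩ := hF
  have h : FPTBounded C fun γ => f (param (C.inst γ)) * ((C.inst γ).n + 1) ^ c :=
    ⟨f, c, hf, fun _ => le_rfl⟩
  refine (hN.mul h).mono fun γ => ?_
  calc ∑ i ∈ Finset.range (N γ), F γ i
      ≤ ∑ _i ∈ Finset.range (N γ), f (param (C.inst γ)) * ((C.inst γ).n + 1) ^ c :=
        Finset.sum_le_sum fun i hi => hb ⟨γ, ⟨i, Finset.mem_range.1 hi⟩⟩
    _ = _ := by simp

/-- The function `F` of the environment is bounded and computable in FPT time: for all locations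
of the variables in registers below `r` there is a program that writes `F` to register `r` and
preserves the registers below `r` and the memory. -/
def Comp (C : Ctx) (F : C.Env → ℕ) : Prop :=
  FPTBounded C F ∧ ∀ (r : ℕ) (loc : (C.Env → ℕ) → ℕ), (∀ v ∈ C.vars, loc v < r) →
    ∃ (p : Prog) (T : C.Env → ℕ), FPTBounded C T ∧
      ∀ (γ : C.Env) (ρ : ℕ → ℕ), (∀ v ∈ C.vars, ρ (loc v) = v γ) →
        ∃ (t : ℕ) (ρ' : ℕ → ℕ),
          Exec p ⟨ρ, (C.inst γ).initState.mem⟩ t ⟨ρ', (C.inst γ).initState.mem⟩ ∧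
          t ≤ T γ ∧ ρ' r = F γ ∧ ∀ i < r, ρ' i = ρ i

/-! ### Programs for arithmetic, branching and loops. -/

namespace Comp

variable {C : Ctx} {F G H N : C.Env → ℕ}

theorem bounded (h : Comp C F) : FPTBounded C F := h.1

theorem congr (h : Comp C F) (e : ∀ γ, G γ = F γ) : Comp C G := by
  rwa [funext e]

theorem var {v : C.Env → ℕ} (hv : v ∈ C.vars) (hb : FPTBounded C v) : Comp C v := by
  refine ⟨hb, fun r loc hloc => ⟨.copy r (loc v), fun _ => 1, FPTBounded.const 1,
    fun γ ρ hρ => ⟨1, _, Exec.copy _ _ _, le_rfl, ?_, fun i hi => ?_⟩⟩⟩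
  · simp [hρ v hv]
  · simp [Function.update_of_ne hi.ne]

theorem const (m : ℕ) : Comp C fun _ => m := by
  refine ⟨FPTBounded.const m, fun r loc hloc => ⟨.const r m, fun _ => 1, FPTBounded.const 1,
    fun γ ρ _ => ⟨1, _, Exec.const _ _ _, le_rfl, ?_, fun i hi => ?_⟩⟩⟩
  · simp
  · simp [Function.update_of_ne hi.ne]

/-- Evaluate two functions to registers `r` and `r + 1` and combine them by one instruction. -/
theorem binary {K : C.Env → ℕ} (hK : FPTBounded C K) (hF : Comp C F) (hG : Comp C G)
    (op : ℕ → Prog) (hop : ∀ (r : ℕ) (γ : C.Env) (ρ : ℕ → ℕ), ρ r = F γ → ρ (r + 1) = G γ →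
      Exec (op r) ⟨ρ, (C.inst γ).initState.mem⟩ 1
        ⟨Function.update ρ r (K γ), (C.inst γ).initState.mem⟩) : Comp C K := by
  refine ⟨hK, fun r loc hloc => ?_⟩
  obtain ⟨p, T, hT, hp⟩ := hF.2 r loc hloc
  obtain ⟨q, U, hU, hq⟩ := hG.2 (r + 1) loc fun v hv => (hloc v hv).trans (Nat.lt_succ_self r)
  refine ⟨.seq p (.seq q (op r)), fun γ => T γ + (U γ + 1), hT.add (hU.add (.const 1)),
    fun γ ρ hρ => ?_⟩
  obtain ⟨t, ρ₁, he, ht, hv, hpres⟩ := hp γ ρ hρ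
  obtain ⟨u, ρ₂, he', hu, hv', hpres'⟩ := hq γ ρ₁ fun v h => by
    rw [hpres _ (hloc v h), hρ v h]
  refine ⟨t + (u + 1), _, he.seq (he'.seq (hop r γ ρ₂ ?_ hv')), by dsimp only; omega,
    by simp, fun i hi => ?_⟩
  · rw [hpres' r (Nat.lt_succ_self r), hv]
  · rw [Function.update_of_ne hi.ne, hpres' i (by omega), hpres i hi]

theorem add (hF : Comp C F) (hG : Comp C G) : Comp C fun γ => F γ + G γ := by
  refine binary (hF.bounded.add hG.bounded) hF hG (fun r => .add r r (r + 1))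
    fun r γ ρ h h' => ?_
  rw [← h, ← h']
  exact Exec.add r r (r + 1) ⟨ρ, _⟩

theorem sub (hF : Comp C F) (hG : Comp C G) : Comp C fun γ => F γ - G γ := by
  refine binary (hF.bounded.mono fun γ => Nat.sub_le _ _) hF hG (fun r => .sub r r (r + 1))
    fun r γ ρ h h' => ?_
  rw [← h, ← h']
  exact Exec.sub r r (r + 1) ⟨ρ, _⟩

theorem load (hF : Comp C F) : Comp C fun γ => (C.inst γ).initState.mem 0 (F γ) := by
  refine binary ((FPTBounded.const 1).mono fun γ => ?_) hF hF (fun r => .load r 0 r)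
    fun r γ ρ h h' => ?_
  · unfold GraphInstance.initState
    dsimp only
    split <;> simp
  · rw [← h]
    exact Exec.load r 0 r ⟨ρ, _⟩

theorem cond (hF : Comp C F) (hG : Comp C G) (hH : Comp C H) :
    Comp C fun γ => if F γ ≠ 0 then G γ else H γ := by
  refine ⟨(hG.bounded.add hH.bounded).mono fun γ => by split <;> omega, fun r loc hloc => ?_⟩
  obtain ⟨p, T, hT, hp⟩ := hF.2 r loc hloc
  obtain ⟨q, U, hU, hq⟩ := hG.2 r loc hloc
  obtain ⟨q', U', hU', hq'⟩ := hH.2 r loc hloc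
  refine ⟨.seq p (.ifNZ r q q'), fun γ => T γ + (U γ + U' γ + 1),
    hT.add ((hU.add hU').add (.const 1)), fun γ ρ hρ => ?_⟩
  obtain ⟨t, ρ₁, he, ht, hv, hpres⟩ := hp γ ρ hρ
  have hρ₁ : ∀ v ∈ C.vars, ρ₁ (loc v) = v γ := fun v h => by rw [hpres _ (hloc v h), hρ v h]
  by_cases h : F γ = 0
  · obtain ⟨u, ρ₂, he', hu, hv', hpres'⟩ := hq' γ ρ₁ hρ₁
    refine ⟨_, ρ₂, he.seq (Exec.ifNZ_false (hv.trans h) he'), by dsimp only; omega,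
      by simp [h, hv'], fun i hi => by rw [hpres' i hi, hpres i hi]⟩
  · obtain ⟨u, ρ₂, he', hu, hv', hpres'⟩ := hq γ ρ₁ hρ₁
    refine ⟨_, ρ₂, he.seq (Exec.ifNZ_true (hv.trans_ne h) he'), by dsimp only; omega,
      by simp [h, hv'], fun i hi => by rw [hpres' i hi, hpres i hi]⟩

/-- Pulling back along a map of environments that keeps the instance and the variables. -/
theorem comap {C' : Ctx} (hF : Comp C F) (e : C'.Env → C.Env)
    (hi : ∀ x, C.inst (e x) = C'.inst x) (hv : ∀ v ∈ C.vars, (fun x => v (e x)) ∈ C'.vars) :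
    Comp C' fun x => F (e x) := by
  have key : ∀ T, FPTBounded C T → FPTBounded C' fun x => T (e x) := by
    rintro T ⟨f, c, hf, h⟩
    exact ⟨f, c, hf, fun x => by rw [← hi]; exact h _⟩
  refine ⟨key _ hF.1, fun r loc hloc => ?_⟩
  obtain ⟨p, T, hT, hp⟩ := hF.2 r (fun v => loc fun x => v (e x)) fun v h => hloc _ (hv v h)
  refine ⟨p, fun x => T (e x), key _ hT, fun x ρ hρ => ?_⟩
  rw [← hi]
  exact hp (e x) ρ fun v h => hρ _ (hv v h)

theorem weak (hF : Comp C F) : Comp (C.ext N) fun x => F x.1 :=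
  hF.comap (C' := C.ext N) (fun x => x.1) (fun _ => rfl) fun v hv => Or.inl ⟨v, hv, rfl⟩

theorem ext_to_loop {A : C.Env → ℕ → ℕ} {F : (C.ext N).Env → ℕ} (hF : Comp (C.ext N) F) :
    Comp (C.loop N A) F :=
  hF.comap (C' := C.loop N A) (fun x => x) (fun _ => rfl) fun _ hv =>
    hv.elim Or.inl fun h => Or.inr (Or.inl h)

theorem index (hN : Comp C N) : Comp (C.ext N) fun x => (x.2 : ℕ) :=
  var (Or.inr rfl) ((hN.weak (N := N)).bounded.mono fun x => x.2.2.le)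

/-- Induction on the number `j` of remaining rounds. Register `r` holds the accumulator, `r + 1` the
index and `r + 2` the countdown; `r + 3` receives the new accumulator value and then the constant 1.
A round costs the body, four bookkeeping instructions and one test, whence `b + 5`; the final test
adds 1. -/
theorem exec_while {C : Ctx} {N : C.Env → ℕ} {A : C.Env → ℕ → ℕ} {U : (C.loop N A).Env → ℕ}
    {r : ℕ} {q : Prog} {γ : C.Env} (ρ₀ : ℕ → ℕ)
    (hq : ∀ (i : Fin (N γ)) (ρ : ℕ → ℕ), (∀ j < r, ρ j = ρ₀ j) → ρ r = A γ i → ρ (r + 1) = i →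
      ∃ (t : ℕ) (ρ' : ℕ → ℕ),
        Exec q ⟨ρ, (C.inst γ).initState.mem⟩ t ⟨ρ', (C.inst γ).initState.mem⟩ ∧
        t ≤ U ⟨γ, i⟩ ∧ ρ' (r + 3) = A γ (i + 1) ∧ ∀ j < r + 3, ρ' j = ρ j)
    (b : ℕ) (hb : ∀ i, U ⟨γ, i⟩ ≤ b) (j : ℕ) (ρ : ℕ → ℕ) (hj : j ≤ N γ)
    (hρ : ∀ j < r, ρ j = ρ₀ j) (hacc : ρ r = A γ (N γ - j)) (hidx : ρ (r + 1) = N γ - j)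
    (hcnt : ρ (r + 2) = j) :
    ∃ (t : ℕ) (ρ' : ℕ → ℕ),
      Exec (.whileNZ (r + 2) (.seq q (.seq (.copy r (r + 3)) (.seq (.const (r + 3) 1)
        (.seq (.add (r + 1) (r + 1) (r + 3)) (.sub (r + 2) (r + 2) (r + 3)))))))
        ⟨ρ, (C.inst γ).initState.mem⟩ t ⟨ρ', (C.inst γ).initState.mem⟩ ∧
      t ≤ j * (b + 5) + 1 ∧ ρ' r = A γ (N γ) ∧ ∀ j < r, ρ' j = ρ₀ j := by
  induction j generalizing ρ with
  | zero => exact ⟨1, ρ, Exec.whileNZ_stop hcnt, by omega, by simpa using hacc, hρ⟩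
  | succ j ih =>
    obtain ⟨t, ρ₁, he, ht, hv, hpres⟩ := hq ⟨N γ - (j + 1), by omega⟩ ρ hρ hacc hidx
    set mm := (C.inst γ).initState.mem
    have hbody := he.seq ((Exec.copy r (r + 3) ⟨ρ₁, mm⟩).seq ((Exec.const (r + 3) 1 _).seq
      ((Exec.add (r + 1) (r + 1) (r + 3) _).seq (Exec.sub (r + 2) (r + 2) (r + 3) _))))
    obtain ⟨u, ρ₂, he', hu, hv', hpres'⟩ := ih (Function.update (Function.update (Function.update
      (Function.update ρ₁ r (A γ (N γ - j))) (r + 3) 1) (r + 1) (N γ - j)) (r + 2) j) (by omega)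
      (fun i hi => by
        rw [Function.update_of_ne (by omega), Function.update_of_ne (by omega),
          Function.update_of_ne (by omega), Function.update_of_ne (by omega),
          hpres i (by omega), hρ i hi])
      (by simp) (by simp) (by simp)
    have h1 := hpres (r + 1) (by omega)
    have h2 := hpres (r + 2) (by omega)
    have hN : N γ - (j + 1) + 1 = N γ - j := by omega
    refine ⟨_, ρ₂, Exec.whileNZ_step (u := u) (by simp [hcnt]) hbody ?_, ?_, hv', hpres'⟩
    · convert he' using 2
      · simp [State.setReg, hv, h1, h2, hidx, hcnt, hN]
      · rfl
    · have := hb ⟨N γ - (j + 1), by omega⟩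
      have h3 : t ≤ b := ht.trans this
      rw [add_mul]
      omega

/-- Iteration with an accumulator. -/
theorem iter {A : C.Env → ℕ → ℕ} (hN : Comp C N) (h₀ : Comp C fun γ => A γ 0)
    (hA : Comp (C.loop N A) fun x => A x.1 (x.2 + 1)) (hb : FPTBounded C fun γ => A γ (N γ)) :
    Comp C fun γ => A γ (N γ) := by
  classical
  refine ⟨hb, fun r loc hloc => ?_⟩
  obtain ⟨p, T, hT, hp⟩ := hN.2 (r + 2) loc fun v hv => by have := hloc v hv; omega
  obtain ⟨p₀, T₀, hT₀, hp₀⟩ := h₀.2 r loc hloc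
  -- Variables are functions, so an old variable may coincide with the index or the accumulator. Any
  -- matching register then holds the right value, and the order of the cases is immaterial.
  let loc' : ((C.loop N A).Env → ℕ) → ℕ := fun g =>
    if h : ∃ v ∈ C.vars, g = fun x => v x.1 then loc h.choose
    else if g = fun x => (x.2 : ℕ) then r + 1 else r
  have hloc' : ∀ g ∈ (C.loop N A).vars, loc' g < r + 3 := by
    intro g hg
    simp only [loc']
    split_ifs with h
    · have := hloc _ h.choose_spec.1
      omega
    · omega
    · omega
  obtain ⟨q, U, ⟨f, c, hf, hU⟩, hq⟩ := hA.2 (r + 3) loc' hloc'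
  have hbd : FPTBounded C fun γ => f (param (C.inst γ)) * ((C.inst γ).n + 1) ^ c :=
    ⟨f, c, hf, fun _ => le_rfl⟩
  refine ⟨.seq p₀ (.seq p (.seq (.const (r + 1) 0) (.whileNZ (r + 2) (.seq q
    (.seq (.copy r (r + 3)) (.seq (.const (r + 3) 1)
        (.seq (.add (r + 1) (r + 1) (r + 3)) (.sub (r + 2) (r + 2) (r + 3))))))))), _,
    hT₀.add (hT.add ((hN.bounded.mul (hbd.add (.const 5))).add (.const 2))), fun γ ρ hρ => ?_⟩
  obtain ⟨t₀, ρ₀, he₀, ht₀, hv₀, hpres₀⟩ := hp₀ γ ρ hρ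
  obtain ⟨t, ρ₁, he, ht, hv, hpres⟩ := hp γ ρ₀ fun v h => by rw [hpres₀ _ (hloc v h), hρ v h]
  have hcst := Exec.const (r + 1) 0 ⟨ρ₁, (C.inst γ).initState.mem⟩
  obtain ⟨u, ρ₂, he', hu, hv', hpres'⟩ := exec_while (C := C) (N := N) (A := A) (U := U) (r := r)
    (q := q) (γ := γ) ρ (fun i ρ' h h' h'' => by
      refine hq ⟨γ, i⟩ ρ' fun g hg => ?_
      simp only [loc']
      split_ifs with h1 h2
      · rw [h _ (hloc _ h1.choose_spec.1), hρ _ h1.choose_spec.1]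
        exact (congrFun h1.choose_spec.2 ⟨γ, i⟩).symm
      · rw [h'', h2]
      · rw [h']
        rcases hg with hg | hg | hg
        · exact absurd hg h1
        · exact absurd hg h2
        · rw [hg])
    (f (param (C.inst γ)) * ((C.inst γ).n + 1) ^ c) (fun i => hU ⟨γ, i⟩) (N γ)
    (Function.update ρ₁ (r + 1) 0) le_rfl
    (fun j hj => by
      rw [Function.update_of_ne (by omega), hpres j (by omega), hpres₀ j hj])
    (by rw [Function.update_of_ne (by omega), hpres r (by omega), hv₀, Nat.sub_self])
    (by simp) (by rw [Function.update_of_ne (by omega), hv])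
  exact ⟨_, ρ₂, he₀.seq (he.seq (hcst.seq he')), by omega, hv', hpres'⟩

theorem acc {A : C.Env → ℕ → ℕ} (h : FPTBounded (C.loop N A) fun x => A x.1 x.2) :
    Comp (C.loop N A) fun x => A x.1 x.2 :=
  var (Or.inr (Or.inr rfl)) h

theorem sum {F : C.Env → ℕ → ℕ} (hN : Comp C N) (hF : Comp (C.ext N) fun x => F x.1 x.2) :
    Comp C fun γ => ∑ i ∈ Finset.range (N γ), F γ i := by
  have hb := hN.bounded.sum hF.bounded
  refine iter (A := fun γ j => ∑ i ∈ Finset.range j, F γ i) hN ((const 0).congr fun γ => by simp)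
    ?_ hb
  refine ((acc ?_).add hF.ext_to_loop).congr fun x => Finset.sum_range_succ _ _
  -- Partial sums are at most the full sum, so one bound serves the accumulator in every round.
  obtain ⟨f, c, hf, h⟩ := hb
  exact ⟨f, c, hf, fun x => (Finset.sum_le_sum_of_subset
    (Finset.range_mono x.2.2.le)).trans (h x.1)⟩

theorem mul (hF : Comp C F) (hG : Comp C G) : Comp C fun γ => F γ * G γ :=
  (sum (F := fun γ _ => G γ) hF hG.weak).congr fun γ => by simp

/-- Powers whose value is bounded. -/
theorem pow (hF : Comp C F) (hN : Comp C N) (hb : FPTBounded C fun γ => (F γ + 1) ^ N γ) :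
    Comp C fun γ => F γ ^ N γ := by
  have hmono : ∀ γ, ∀ i ≤ N γ, F γ ^ i ≤ (F γ + 1) ^ N γ := fun γ i hi =>
    (Nat.pow_le_pow_left (Nat.le_succ _) i).trans (Nat.pow_le_pow_right (Nat.succ_pos _) hi)
  refine iter (A := fun γ j => F γ ^ j) hN ((const 1).congr fun γ => by simp) ?_
    (hb.mono fun γ => hmono γ _ le_rfl)
  refine ((acc ?_).mul (hF.weak (N := N)).ext_to_loop).congr fun x => pow_succ _ _
  obtain ⟨f, c, hf, h⟩ := hb
  exact ⟨f, c, hf, fun x => (hmono x.1 _ x.2.2.le).trans (h x.1)⟩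

end Comp

end RAM

/-! ### Decidable predicates, bounded quantifiers and division. -/

namespace RAM

open Classical in
/-- The truth value of a proposition as a number. -/
noncomputable def ind (P : Prop) : ℕ := if P then 1 else 0

@[simp] theorem ind_true {P : Prop} (h : P) : ind P = 1 := if_pos h

@[simp] theorem ind_false {P : Prop} (h : ¬P) : ind P = 0 := if_neg h

/-- A predicate on environments is decidable in FPT time. -/
def CompP (C : Ctx) (P : C.Env → Prop) : Prop := Comp C fun γ => ind (P γ)

section Closure

variable {C : Ctx} {F G N : C.Env → ℕ} {P Q : C.Env → Prop}

theorem CompP.congr (h : CompP C P) (e : ∀ γ, Q γ ↔ P γ) : CompP C Q := by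
  rwa [show Q = P from funext fun γ => propext (e γ)]

theorem CompP.weak (h : CompP C P) : CompP (C.ext N) fun x => P x.1 := Comp.weak h

theorem Comp.ite [∀ γ, Decidable (P γ)] (h : CompP C P) (hF : Comp C F) (hG : Comp C G) :
    Comp C fun γ => if P γ then F γ else G γ :=
  (Comp.cond h hF hG).congr fun γ => by by_cases h : P γ <;> simp [h]

theorem CompP.not (h : CompP C P) : CompP C fun γ => ¬P γ :=
  Comp.congr ((Comp.const 1).sub h) fun γ => by by_cases h : P γ <;> simp [h]

theorem CompP.and (h : CompP C P) (h' : CompP C Q) : CompP C fun γ => P γ ∧ Q γ :=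
  Comp.congr (Comp.mul h h') fun γ => by by_cases h : P γ <;> by_cases h' : Q γ <;> simp [h, h']

theorem CompP.or (h : CompP C P) (h' : CompP C Q) : CompP C fun γ => P γ ∨ Q γ :=
  (h.not.and h'.not).not.congr fun γ => by tauto

theorem CompP.imp (h : CompP C P) (h' : CompP C Q) : CompP C fun γ => P γ → Q γ :=
  (h.and h'.not).not.congr fun γ => by tauto

theorem CompP.le (hF : Comp C F) (hG : Comp C G) : CompP C fun γ => F γ ≤ G γ :=
  Comp.congr ((Comp.const 1).sub (hF.sub hG)) fun γ => by
    by_cases h : F γ ≤ G γ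
    · simp [h]
    · rw [ind_false h]; omega

theorem CompP.lt (hF : Comp C F) (hG : Comp C G) : CompP C fun γ => F γ < G γ :=
  (CompP.le hG hF).not.congr fun γ => by omega

theorem CompP.eq (hF : Comp C F) (hG : Comp C G) : CompP C fun γ => F γ = G γ :=
  ((CompP.le hF hG).and (CompP.le hG hF)).congr fun γ => by omega

theorem CompP.exists_lt {P : C.Env → ℕ → Prop} (hN : Comp C N)
    (h : CompP (C.ext N) fun x => P x.1 x.2) : CompP C fun γ => ∃ i < N γ, P γ i := by
  refine (CompP.lt (Comp.const 0) (Comp.sum (F := fun γ i => ind (P γ i)) hN h)).congr fun γ => ?_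
  rw [Finset.sum_pos_iff]
  refine exists_congr fun i => ?_
  by_cases h : P γ i <;> simp [h]

theorem CompP.forall_lt {P : C.Env → ℕ → Prop} (hN : Comp C N)
    (h : CompP (C.ext N) fun x => P x.1 x.2) : CompP C fun γ => ∀ i < N γ, P γ i :=
  (CompP.exists_lt (P := fun γ i => ¬P γ i) hN h.not).not.congr fun γ => by
    push Not; rfl

/-- For a positive divisor the quotient is the number of `i < F γ` with `(i + 1) * G γ ≤ F γ`. -/
theorem Comp.div (hF : Comp C F) (hG : Comp C G) : Comp C fun γ => F γ / G γ := by
  refine Comp.ite (P := fun γ => G γ = 0) (F := fun _ => 0) (CompP.eq hG (Comp.const 0))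
    (Comp.const 0) (Comp.sum (F := fun γ i => ind ((i + 1) * G γ ≤ F γ)) hF
      (CompP.le ((hF.index.add (Comp.const 1)).mul hG.weak) hF.weak)) |>.congr fun γ => ?_
  split_ifs with h
  · simp [h]
  · have hpos : 0 < G γ := Nat.pos_of_ne_zero h
    rw [Finset.sum_congr rfl (g := fun i => if i < F γ / G γ then 1 else 0)]
    · rw [← Finset.card_filter]
      have : (Finset.range (F γ)).filter (· < F γ / G γ) = Finset.range (F γ / G γ) := by
        ext i
        have := Nat.div_le_self (F γ) (G γ)
        simp only [Finset.mem_filter, Finset.mem_range]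
        omega
      rw [this, Finset.card_range]
    · intro i _
      have : (i + 1) * G γ ≤ F γ ↔ i < F γ / G γ := by
        rw [← Nat.le_div_iff_mul_le hpos, Nat.succ_le_iff]
      by_cases hi : i < F γ / G γ <;> simp [this, hi]

theorem Comp.mod (hF : Comp C F) (hG : Comp C G) : Comp C fun γ => F γ % G γ :=
  (hF.sub (hG.mul (hF.div hG))).congr fun γ => by
    rw [Nat.mod_eq_sub_mul_div]

theorem Comp.minimum (hF : Comp C F) (hG : Comp C G) : Comp C fun γ => min (F γ) (G γ) :=
  (hF.sub (hF.sub hG)).congr fun γ => by omega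

end Closure

/-- Contexts in which the numbers `n, k, d, s` of the instance are available. -/
class Standard (C : Ctx) : Prop where
  n : Comp C fun γ => (C.inst γ).n
  k : Comp C fun γ => (C.inst γ).k
  d : Comp C fun γ => (C.inst γ).d
  s : Comp C fun γ => (C.inst γ).s

instance (C : Ctx) (N : C.Env → ℕ) [h : Standard C] : Standard (C.ext N) :=
  ⟨h.n.weak, h.k.weak, h.d.weak, h.s.weak⟩

/-! ### The search algorithm -/

/-- The number of `u < v` with property `P`. -/
noncomputable def cnt (P : ℕ → Prop) (v : ℕ) : ℕ := ∑ u ∈ Finset.range v, ind (P u)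

/-- The element of rank `t` among the numbers below `n` with property `P`, if there is one. -/
noncomputable def select (n : ℕ) (P : ℕ → Prop) (t : ℕ) : ℕ :=
  ∑ v ∈ Finset.range n, ind (cnt P (v + 1) ≤ t)

theorem Comp.cnt {C : Ctx} {v : C.Env → ℕ} {P : C.Env → ℕ → Prop} (hv : Comp C v)
    (hP : CompP (C.ext v) fun x => P x.1 x.2) : Comp C fun γ => cnt (P γ) (v γ) :=
  Comp.sum hv hP

end RAM

namespace GraphInstance

open RAM

variable (I : GraphInstance)

/-- Adjacency of vertices given by numbers. -/
def adj (u v : ℕ) : Prop := ∃ (hu : u < I.n) (hv : v < I.n), I.G.Adj ⟨u, hu⟩ ⟨v, hv⟩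

/-- The degree of a vertex. -/
noncomputable def deg (v : ℕ) : ℕ := cnt (I.adj v) I.n

/-- The vertex of rank `t` among the vertices of degree larger than `d`. -/
noncomputable def hub (t : ℕ) : ℕ := select I.n (fun v => I.d < I.deg v) t

/-- The neighbor of rank `t` of `v`. -/
noncomputable def nbr (v t : ℕ) : ℕ := select I.n (I.adj v) t

/-- The slot of the center in the row of `b`; slot `i * k + j` belongs to the row of color `i` and
has color `j`. -/
def center (b : ℕ) : ℕ := b / I.k * I.k + b / I.k

/-- The slot whose vertex determines the vertex in slot `b`. -/
def root (μ : ℕ → ℕ) (b : ℕ) : ℕ := if I.s ≤ μ b ∧ μ b < I.s + I.d then I.center b else b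

/-- The vertex in slot `b` if the slot `a` holds `v`: the mode `μ b` refers to a vertex of high
degree, to a neighbor of `v`, or to `v` itself. -/
noncomputable def val (μ : ℕ → ℕ) (a v b : ℕ) : ℕ :=
  if μ b < I.s then I.hub (μ b) else if b = a then v else I.nbr v (μ b - I.s)

/-- The vertex in slot `b` is known once the vertex in slot `a` is. -/
def active (μ : ℕ → ℕ) (a b : ℕ) : Prop := μ b < I.s ∨ I.root μ b = a

/-- The vertices `u, v` in slots `a, b` are compatible. -/
def compat (R : ℕ → ℕ → Prop) (a b u v : ℕ) : Prop :=
  (a % I.k = b % I.k → ¬I.adj u v) ∧ (¬a % I.k = b % I.k → ¬u = v) ∧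
    (a = I.center b → R (b / I.k) (b % I.k) → I.adj u v)

/-- The vertex `v` is a candidate for the slot `a`. -/
def valid (R : ℕ → ℕ → Prop) (μ : ℕ → ℕ) (a v : ℕ) : Prop :=
  ∀ b < I.k * I.k, I.active μ a b → I.val μ a v b < I.n ∧
    (μ b < I.s ∨ I.deg (I.val μ a v b) ≤ I.d) ∧
    ∀ e < I.k * I.k, I.active μ a e → I.compat R b e (I.val μ a v b) (I.val μ a v e)

/-- The vertex in slot `b` for the modes `μ` and the ranks `τ` of the candidates. -/
noncomputable def slot (R : ℕ → ℕ → Prop) (μ τ : ℕ → ℕ) (b : ℕ) : ℕ :=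
  I.val μ (I.root μ b) (select I.n (I.valid R μ (I.root μ b)) (τ (I.root μ b))) b

/-- The vertices in the slots form a witness. -/
def IsSolution (R : ℕ → ℕ → Prop) (x : ℕ → ℕ) : Prop :=
  ∀ b < I.k * I.k, x b < I.n ∧ ∀ e < I.k * I.k, I.compat R b e (x b) (x e)

/-- The number of modes. -/
def modes : ℕ := I.s + I.d + 1

/-- The number of candidates that are tried for a slot. -/
def ranks : ℕ := I.k * I.k * ((I.d + 1) * (I.d + 1) * (I.d + 1)) + 1

/-- The digit `b` of `c` in base `B`. -/
def digit (B c b : ℕ) : ℕ := c / B ^ (min b (I.k * I.k)) % B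

/-- The search succeeds. -/
def Accepts (R : ℕ → ℕ → Prop) : Prop :=
  ∃ c < I.modes ^ (I.k * I.k), ∃ e < I.ranks ^ (I.k * I.k),
    I.IsSolution R (I.slot R (I.digit I.modes c) (I.digit I.ranks e))

end GraphInstance

/-! ### The search runs in FPT time. -/

namespace RAM

section Algorithm

variable {C : Ctx} [S : Standard C] {a b c e t u v : C.Env → ℕ}

/-- The range tests are needed because the address `u * n + v` determines the pair only for `v < n`.
-/
theorem CompP.adj (hu : Comp C u) (hv : Comp C v) :
    CompP C fun γ => (C.inst γ).adj (u γ) (v γ) := by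
  refine (((CompP.lt hu S.n).and (CompP.lt hv S.n)).and
    (CompP.eq ((hu.mul S.n).add hv).load (Comp.const 1))).congr fun γ => ?_
  simp only [GraphInstance.adj, GraphInstance.initState, true_and, ite_eq_left_iff, zero_ne_one,
    imp_false, not_not]
  constructor
  · rintro ⟨h1, h2, h⟩
    exact ⟨⟨h1, h2⟩, _, _, rfl, h⟩
  · rintro ⟨⟨h1, h2⟩, i, j, h, hadj⟩
    have hi : u γ = i := by
      have := congrArg (· / (C.inst γ).n) h
      simpa [Nat.mul_comm _ (C.inst γ).n, Nat.mul_add_div (Nat.zero_lt_of_lt h1),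
        Nat.div_eq_of_lt h2, Nat.div_eq_of_lt j.2] using this
    have hj : v γ = j := by rw [hi] at h; omega
    exact ⟨h1, h2, by convert hadj⟩

theorem Comp.select {P : C.Env → ℕ → Prop} (ht : Comp C t)
    (hP : ∀ N : (C.ext fun γ => (C.inst γ).n).Env → ℕ, Comp (C.ext fun γ => (C.inst γ).n) N →
      CompP ((C.ext fun γ => (C.inst γ).n).ext N)
        fun x => P (x.1 : (C.ext fun γ => (C.inst γ).n).Env).1 x.2) :
    Comp C fun γ => select (C.inst γ).n (P γ) (t γ) :=
  Comp.sum (F := fun γ v => ind (RAM.cnt (P γ) (v + 1) ≤ t γ)) S.n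
    (CompP.le (Comp.cnt (P := fun x : (C.ext fun γ => (C.inst γ).n).Env => P x.1)
      (S.n.index.add (Comp.const 1))
      (hP _ (S.n.index.add (Comp.const 1)))) ht.weak)

theorem Comp.deg (hv : Comp C v) : Comp C fun γ => (C.inst γ).deg (v γ) :=
  Comp.cnt S.n (CompP.adj hv.weak S.n.index)

theorem Comp.hub (ht : Comp C t) : Comp C fun γ => (C.inst γ).hub (t γ) :=
  Comp.select (P := fun γ v => (C.inst γ).d < (C.inst γ).deg v) ht fun _ hN =>
    CompP.lt S.d.weak.weak (Comp.deg hN.index)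

theorem Comp.nbr (hv : Comp C v) (ht : Comp C t) :
    Comp C fun γ => (C.inst γ).nbr (v γ) (t γ) :=
  Comp.select (P := fun γ => (C.inst γ).adj (v γ)) ht fun _ hN =>
    CompP.adj hv.weak.weak hN.index

theorem Comp.center (hb : Comp C b) : Comp C fun γ => (C.inst γ).center (b γ) :=
  ((hb.div S.k).mul S.k).add (hb.div S.k)

theorem Comp.slots : Comp C fun γ => (C.inst γ).k * (C.inst γ).k := S.k.mul S.k

/-- Capping the exponent at `k * k`, as in `digit`, keeps the power bounded in the parameter for
arbitrary `b`. The strict bound on `B` absorbs the `+ 1` in the hypothesis of `Comp.pow`. -/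
theorem Comp.digits {B : GraphInstance → ℕ} {g : ℕ → ℕ} (hg : Computable g)
    (hB : ∀ I, B I < g (param I)) (hBC : Comp C fun γ => B (C.inst γ)) (hb : Comp C b) :
    Comp C fun γ => B (C.inst γ) ^ min (b γ) ((C.inst γ).k * (C.inst γ).k) := by
  refine hBC.pow (hb.minimum Comp.slots) (FPTBounded.of_param (f := fun x => g x ^ (x * x))
    (computable_pow hg (computable_mul Computable.id Computable.id)) fun γ => ?_)
  have hk : (C.inst γ).k ≤ param (C.inst γ) := by unfold param; omega
  refine (Nat.pow_le_pow_left (hB _) _).trans (Nat.pow_le_pow_right ?_ ?_)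
  · exact Nat.zero_lt_of_lt (hB _)
  · exact (min_le_right _ _).trans (Nat.mul_le_mul hk hk)

theorem Comp.modes : Comp C fun γ => (C.inst γ).modes := (S.s.add S.d).add (Comp.const 1)

theorem Comp.ranks : Comp C fun γ => (C.inst γ).ranks :=
  have h := S.d.add (Comp.const 1)
  ((Comp.slots).mul ((h.mul h).mul h)).add (Comp.const 1)

theorem Comp.modes_pow (hb : Comp C b) :
    Comp C fun γ => (C.inst γ).modes ^ min (b γ) ((C.inst γ).k * (C.inst γ).k) :=
  Comp.digits (g := fun x => x + 2) (computable_add Computable.id (Computable.const 2))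
    (fun I => by unfold GraphInstance.modes param; omega) Comp.modes hb

theorem Comp.ranks_pow (hb : Comp C b) :
    Comp C fun γ => (C.inst γ).ranks ^ min (b γ) ((C.inst γ).k * (C.inst γ).k) := by
  have h1 : Computable fun x : ℕ => x + 1 := computable_add Computable.id (Computable.const 1)
  refine Comp.digits (g := fun x => x * x * ((x + 1) * (x + 1) * (x + 1)) + 2)
    (computable_add (computable_mul (computable_mul Computable.id Computable.id)
      (computable_mul (computable_mul h1 h1) h1)) (Computable.const 2))
    (fun I => ?_) Comp.ranks hb
  have hk : I.k ≤ param I := by unfold param; omega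
  have hd : I.d + 1 ≤ param I + 1 := by unfold param; omega
  have := Nat.mul_le_mul (Nat.mul_le_mul hk hk) (Nat.mul_le_mul (Nat.mul_le_mul hd hd) hd)
  unfold GraphInstance.ranks
  omega

theorem Comp.mode (hc : Comp C c) (hb : Comp C b) :
    Comp C fun γ => (C.inst γ).digit (C.inst γ).modes (c γ) (b γ) :=
  (hc.div (Comp.modes_pow hb)).mod Comp.modes

theorem Comp.rank (hc : Comp C c) (hb : Comp C b) :
    Comp C fun γ => (C.inst γ).digit (C.inst γ).ranks (c γ) (b γ) :=
  (hc.div (Comp.ranks_pow hb)).mod Comp.ranks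

theorem Comp.root (hc : Comp C c) (hb : Comp C b) :
    Comp C fun γ => (C.inst γ).root ((C.inst γ).digit (C.inst γ).modes (c γ)) (b γ) :=
  have hμ := Comp.mode hc hb
  Comp.ite ((CompP.le S.s hμ).and (CompP.lt hμ (S.s.add S.d))) hb.center hb

theorem Comp.val (hc : Comp C c) (ha : Comp C a) (hv : Comp C v) (hb : Comp C b) :
    Comp C fun γ => (C.inst γ).val ((C.inst γ).digit (C.inst γ).modes (c γ)) (a γ) (v γ) (b γ) :=
  have hμ := Comp.mode hc hb
  Comp.ite (CompP.lt hμ S.s) hμ.hub (Comp.ite (CompP.eq hb ha) hv (Comp.nbr hv (hμ.sub S.s)))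

theorem CompP.active (hc : Comp C c) (ha : Comp C a) (hb : Comp C b) :
    CompP C fun γ => (C.inst γ).active ((C.inst γ).digit (C.inst γ).modes (c γ)) (a γ) (b γ) :=
  (CompP.lt (Comp.mode hc hb) S.s).or (CompP.eq (Comp.root hc hb) ha)

/-- A relation between numbers that is decidable in FPT time in every context. -/
def CompRel (R : ℕ → ℕ → Prop) : Prop :=
  ∀ (C : Ctx) (a b : C.Env → ℕ), Comp C a → Comp C b → CompP C fun γ => R (a γ) (b γ)

variable {R : ℕ → ℕ → Prop}

theorem CompP.compat (hR : CompRel R) (ha : Comp C a) (hb : Comp C b) (hu : Comp C u)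
    (hv : Comp C v) : CompP C fun γ => (C.inst γ).compat R (a γ) (b γ) (u γ) (v γ) :=
  have hcol := CompP.eq (ha.mod S.k) (hb.mod S.k)
  (hcol.imp (CompP.adj hu hv).not).and ((hcol.not.imp (CompP.eq hu hv).not).and
    ((CompP.eq ha hb.center).imp ((hR C _ _ (hb.div S.k) (hb.mod S.k)).imp (CompP.adj hu hv))))

theorem CompP.valid (hR : CompRel R) (hc : Comp C c) (ha : Comp C a) (hv : Comp C v) :
    CompP C fun γ => (C.inst γ).valid R ((C.inst γ).digit (C.inst γ).modes (c γ)) (a γ) (v γ) := by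
  refine CompP.forall_lt Comp.slots ?_
  have hb := Comp.index (C := C) Comp.slots
  have hval := Comp.val hc.weak ha.weak hv.weak hb
  refine (CompP.active hc.weak ha.weak hb).imp ((CompP.lt hval S.n.weak).and
    (((CompP.lt (Comp.mode hc.weak hb) S.s.weak).or (CompP.le hval.deg S.d.weak)).and
    (CompP.forall_lt Comp.slots ?_)))
  have hb' := Comp.index (C := C.ext fun γ => (C.inst γ).k * (C.inst γ).k) Comp.slots
  exact (CompP.active hc.weak.weak ha.weak.weak hb').imp (CompP.compat hR hb.weak hb' hval.weak
    (Comp.val hc.weak.weak ha.weak.weak hv.weak.weak hb'))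

theorem Comp.slot (hR : CompRel R) (hc : Comp C c) (he : Comp C e) (hb : Comp C b) :
    Comp C fun γ => (C.inst γ).slot R ((C.inst γ).digit (C.inst γ).modes (c γ))
      ((C.inst γ).digit (C.inst γ).ranks (e γ)) (b γ) :=
  have hr := Comp.root hc hb
  Comp.val hc hr (Comp.select (P := fun γ => (C.inst γ).valid R _ _) (Comp.rank he hr)
    fun _ hN => CompP.valid hR hc.weak.weak hr.weak.weak hN.index) hb

theorem CompP.isSolution_slot (hR : CompRel R) (hc : Comp C c) (he : Comp C e) :
    CompP C fun γ => (C.inst γ).IsSolution R ((C.inst γ).slot R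
      ((C.inst γ).digit (C.inst γ).modes (c γ)) ((C.inst γ).digit (C.inst γ).ranks (e γ))) := by
  refine CompP.forall_lt Comp.slots ?_
  have hb := Comp.index (C := C) Comp.slots
  have hx := Comp.slot hR hc.weak he.weak hb
  refine (CompP.lt hx S.n.weak).and (CompP.forall_lt Comp.slots ?_)
  have hb' := Comp.index (C := C.ext fun γ => (C.inst γ).k * (C.inst γ).k) Comp.slots
  exact CompP.compat hR hb.weak hb' hx.weak (Comp.slot hR hc.weak.weak he.weak.weak hb')

theorem CompP.accepts (hR : CompRel R) : CompP C fun γ => (C.inst γ).Accepts R := by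
  have hm : Comp C fun γ => (C.inst γ).modes ^ ((C.inst γ).k * (C.inst γ).k) :=
    (Comp.modes_pow Comp.slots).congr fun γ => by rw [min_self]
  refine CompP.exists_lt hm ?_
  have hr : Comp (C.ext fun γ => (C.inst γ).modes ^ ((C.inst γ).k * (C.inst γ).k))
      fun x => (C.inst x.1).ranks ^ ((C.inst x.1).k * (C.inst x.1).k) :=
    Comp.weak (F := fun γ => (C.inst γ).ranks ^ ((C.inst γ).k * (C.inst γ).k))
      ((Comp.ranks_pow Comp.slots).congr fun γ => by rw [min_self])
  refine CompP.exists_lt hr ?_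
  exact CompP.isSolution_slot hR hm.index.weak hr.index

/-- The context in which only the numbers `n, k, d, s` of the instance are available. -/
def Ctx.base : Ctx where
  Env := GraphInstance
  inst I := I
  vars := {GraphInstance.n, GraphInstance.k, GraphInstance.d, GraphInstance.s}

instance : Standard Ctx.base where
  n := Comp.var (Or.inl rfl) ⟨fun _ => 1, 1, Computable.const 1, fun I => by simp⟩
  k := Comp.var (Or.inr (Or.inl rfl))
    (FPTBounded.of_param Computable.id fun I => by simp only [param, id]; omega)
  d := Comp.var (Or.inr (Or.inr (Or.inl rfl)))
    (FPTBounded.of_param Computable.id fun I => by simp only [param, id]; omega)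
  s := Comp.var (Or.inr (Or.inr (Or.inr rfl)))
    (FPTBounded.of_param Computable.id fun I => by simp only [param, id]; omega)

theorem decidableInFPTTime_of_compP {P Q : GraphInstance → Prop}
    (h : CompP Ctx.base fun I : GraphInstance => Q I) :
    DecidableInFPTTime P (fun I => I.k + I.d + I.s) Q := by
  classical
  let loc : (GraphInstance → ℕ) → ℕ := fun v =>
    if v = GraphInstance.n then 0 else if v = GraphInstance.k then 1
    else if v = GraphInstance.d then 2 else 3
  -- Registers 0 to 3 hold the input, so the result is computed in register 4. Copying it to
  -- register 0 costs one more step, which is paid for by `f x + 1` since `(n + 1) ^ c ≥ 1`.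
  obtain ⟨p, T, ⟨f, c, hf, hT⟩, hp⟩ := h.2 4 loc fun v _ => by
    simp only [loc]; split_ifs <;> omega
  refine ⟨.seq p (.copy 0 4), fun x => f x + 1, c, computable_add hf (Computable.const 1),
    fun I _ => ?_⟩
  obtain ⟨t, ρ, he, ht, hv, -⟩ := hp I I.initState.reg fun v hv => by
    simp only [loc]
    split_ifs with h₁ h₂ h₃
    · rw [h₁]; rfl
    · rw [h₂]; rfl
    · rw [h₃]; rfl
    · rcases hv with h | h | h | h
      · exact absurd h h₁
      · exact absurd h h₂
      · exact absurd h h₃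
      · rw [h]; rfl
  refine ⟨t + 1, _, he.seq (Exec.copy 0 4 _), ?_, ?_⟩
  · have h1 := ht.trans (hT I)
    have h2 : 1 ≤ (I.n + 1) ^ c := Nat.one_le_pow _ _ (Nat.succ_pos _)
    rw [add_mul, one_mul]
    exact add_le_add h1 h2
  · simp only [State.setReg, Function.update_self, hv, ind]

end Algorithm

end RAM

/-! ### Ranks, digits and the exchange argument. -/

namespace RAM

variable {n t v w : ℕ} {P : ℕ → Prop}

theorem cnt_zero : cnt P 0 = 0 := by simp [cnt]

theorem cnt_succ (v : ℕ) : cnt P (v + 1) = cnt P v + ind (P v) := Finset.sum_range_succ _ _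

theorem cnt_mono (h : v ≤ w) : cnt P v ≤ cnt P w :=
  Finset.sum_le_sum_of_subset (Finset.range_mono h)

theorem cnt_lt_cnt (hv : P v) (h : v < w) : cnt P v < cnt P w := by
  have h₁ : cnt P (v + 1) ≤ cnt P w := cnt_mono h
  rw [cnt_succ, ind_true hv] at h₁
  omega

theorem cnt_eq_card [DecidablePred P] : cnt P n = ((Finset.range n).filter P).card := by
  rw [Finset.card_filter]
  exact Finset.sum_congr rfl fun v _ => by by_cases h : P v <;> simp [h]

/-- A downward closed predicate cuts out an initial segment, whose length is its count. -/
theorem cnt_iff_lt (hP : ∀ u v, u ≤ v → P v → P u) (h : v < n) : P v ↔ v < cnt P n := by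
  induction n generalizing v with
  | zero => omega
  | succ n ih =>
    rw [cnt_succ]
    have hle : cnt P n ≤ n := by
      classical
      rw [cnt_eq_card]
      exact (Finset.card_filter_le _ _).trans (by simp)
    by_cases hn : P n
    · have hcn : n ≤ cnt P n := by
        by_contra hlt
        push Not at hlt
        exact absurd ((ih hlt).1 (hP _ _ hlt.le hn)) (lt_irrefl _)
      rw [ind_true hn]
      exact ⟨fun _ => by omega, fun _ => hP _ _ (by omega) hn⟩
    · rw [ind_false hn, Nat.add_zero]
      rcases Nat.lt_succ_iff_lt_or_eq.1 h with h | rfl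
      · exact ih h
      · exact ⟨fun h => absurd h hn, fun h => by omega⟩

/-- The condition that is counted in `select` is downward closed: it holds exactly for the numbers
before the element of rank `t`. If there is no such element, it holds for all numbers below `n` and
the value is `n`. -/
theorem lt_select_iff (h : v < n) : cnt P (v + 1) ≤ t ↔ v < select n P t :=
  cnt_iff_lt (P := fun v => cnt P (v + 1) ≤ t)
    (fun _ _ huv h => (cnt_mono (Nat.succ_le_succ huv)).trans h) h

theorem select_cnt (hv : P v) (h : v < n) : select n P (cnt P v) = v := by
  apply le_antisymm
  · by_contra hlt
    push Not at hlt
    have := (lt_select_iff h).2 hlt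
    rw [cnt_succ, ind_true hv] at this
    omega
  · by_contra hlt
    push Not at hlt
    exact absurd ((lt_select_iff (hlt.trans h)).1 (cnt_mono hlt)) (lt_irrefl _)

theorem select_prop (h : select n P t < n) : P (select n P t) := by
  by_contra hP
  have h₁ : ¬cnt P (select n P t + 1) ≤ t := fun h' => lt_irrefl _ ((lt_select_iff h).1 h')
  rw [cnt_succ, ind_false hP, Nat.add_zero] at h₁
  rcases Nat.eq_zero_or_pos (select n P t) with h₀ | h₀
  · rw [h₀, cnt_zero] at h₁
    omega
  · obtain ⟨w, hw⟩ := Nat.exists_eq_succ_of_ne_zero h₀.ne'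
    rw [hw] at h₁
    exact h₁ ((lt_select_iff (v := w) (n := n) (by omega)).2 (by omega))

open Classical in
theorem card_first (n t : ℕ) :
    ((Finset.range n).filter fun v => P v ∧ cnt P v < t).card = min t (cnt P n) := by
  induction n with
  | zero => simp [cnt_zero]
  | succ n ih =>
    rw [Finset.range_add_one, Finset.filter_insert, cnt_succ]
    split_ifs with h
    · rw [Finset.card_insert_of_notMem (by simp), ih, ind_true h.1]
      omega
    · rw [ih]
      by_cases hP : P n
      · have : t ≤ cnt P n := by simpa [hP] using h
        omega
      · simp [hP]

theorem exists_digits (B m : ℕ) (g : ℕ → ℕ) (hg : ∀ b < m, g b < B) :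
    ∃ c < B ^ m, ∀ b < m, c / B ^ b % B = g b := by
  refine ⟨finFunctionFinEquiv (fun b : Fin m => ⟨g b, hg b b.2⟩), Fin.is_lt _, fun b hb => ?_⟩
  have := congrArg Fin.val (congrFun (finFunctionFinEquiv.symm_apply_apply
    (fun b : Fin m => (⟨g b, hg b b.2⟩ : Fin B))) ⟨b, hb⟩)
  simpa [finFunctionFinEquiv] using this

open Classical in
/-- If the conflicts of a family of choices are sparse, then every choice that is not among
sufficiently many given candidates can be replaced by one of them. -/
theorem exists_choice (A : Finset ℕ) (L : ℕ → Finset ℕ) (U : ℕ → ℕ → Prop)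
    (ok : ℕ → ℕ → ℕ → ℕ → Prop) (D : ℕ)
    (hsymm : ∀ a v a' v', ok a v a' v' → ok a' v' a v) (hLU : ∀ a ∈ A, ∀ v ∈ L a, U a v)
    (hD : ∀ a ∈ A, ∀ a' ∈ A, a ≠ a' → ∀ v', U a' v' →
      ((L a).filter fun v => ¬ok a v a' v').card ≤ D)
    (x₀ : ℕ → ℕ) (hx₀ : ∀ a ∈ A, U a (x₀ a))
    (hok : ∀ a ∈ A, ∀ a' ∈ A, a ≠ a' → ok a (x₀ a) a' (x₀ a'))
    (hL : ∀ a ∈ A, x₀ a ∈ L a ∨ A.card * D < (L a).card) :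
    ∃ x : ℕ → ℕ, ∀ a ∈ A, x a ∈ L a ∧ ∀ a' ∈ A, a ≠ a' → ok a (x a) a' (x a') := by
  -- The induction is on the number of indices whose current choice lies outside its list. The
  -- choices stay in `U` and pairwise compatible throughout.
  induction hN : (A.filter fun a => x₀ a ∉ L a).card generalizing x₀ with
  | zero =>
    rw [Finset.card_eq_zero, Finset.filter_eq_empty_iff] at hN
    exact ⟨x₀, fun a ha => ⟨not_not.1 (hN ha), hok a ha⟩⟩
  | succ N ih =>
    obtain ⟨a, ha⟩ : (A.filter fun a => x₀ a ∉ L a).Nonempty := by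
      rw [← Finset.card_pos]; omega
    obtain ⟨haA, haL⟩ := Finset.mem_filter.1 ha
    have hlarge := (hL a haA).resolve_left haL
    -- Each other index rules out at most `D` elements of `L a`, and `L a` has more than `A.card *
    -- D` elements.
    obtain ⟨v, hvL, hv⟩ : ∃ v ∈ L a, ∀ a' ∈ A, a ≠ a' → ok a v a' (x₀ a') := by
      by_contra hcon
      push Not at hcon
      have hsub : L a ⊆ (A.filter (a ≠ ·)).biUnion
          fun a' => (L a).filter fun v => ¬ok a v a' (x₀ a') := by
        intro v hv
        obtain ⟨a', h₁, h₂, h₃⟩ := hcon v hv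
        simp only [Finset.mem_biUnion, Finset.mem_filter]
        exact ⟨a', ⟨h₁, h₂⟩, hv, h₃⟩
      have h₁ := (Finset.card_le_card hsub).trans (Finset.card_biUnion_le_card_mul _ _ D
        fun a' ha' => hD a haA a' (Finset.mem_filter.1 ha').1 (Finset.mem_filter.1 ha').2 _
          (hx₀ a' (Finset.mem_filter.1 ha').1))
      have h₂ := Nat.mul_le_mul_right D (Finset.card_filter_le A (a ≠ ·))
      omega
    refine ih (Function.update x₀ a v) ?_ ?_ ?_ ?_
    · intro b hb
      by_cases h : b = a
      · subst h; simpa using hLU b hb v hvL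
      · simpa [h] using hx₀ b hb
    · intro b hb b' hb' hne
      by_cases h : b = a
      · subst h
        simpa [hne.symm] using hv b' hb' hne
      · by_cases h' : b' = a
        · subst h'
          simpa [h] using hsymm _ _ _ _ (hv b hb (Ne.symm h))
        · simpa [h, h'] using hok b hb b' hb' hne
    · intro b hb
      by_cases h : b = a
      · subst h; left; simpa using hvL
      · simpa [h] using hL b hb
    · have : (A.filter fun b => Function.update x₀ a v b ∉ L b)
          = (A.filter fun a => x₀ a ∉ L a).erase a := by
        ext b
        by_cases h : b = a
        · subst h; simp [hvL]
        · simp [h]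
      rw [this, Finset.card_erase_of_mem ha, hN]
      rfl

end RAM

/-! ### Witnesses as fillings of the slots. -/

namespace GraphInstance

open RAM

variable (I : GraphInstance) {R : ℕ → ℕ → Prop}

/-- A set of vertices with a proper coloring such that every class `i` has a vertex with
neighbors in all classes `j` with `R i j`. -/
def HasWitness (R : ℕ → ℕ → Prop) : Prop :=
  ∃ (S : Set (Fin I.n)) (c : (I.G.induce S).Coloring (Fin I.k)), ∀ i : Fin I.k,
    ∃ v : S, c v = i ∧ ∀ j : Fin I.k, R i j → ∃ w : S, (I.G.induce S).Adj v w ∧ c w = j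

variable {I}

theorem adj_symm {u v : ℕ} (h : I.adj u v) : I.adj v u := by
  obtain ⟨hu, hv, h⟩ := h
  exact ⟨hv, hu, h.symm⟩

theorem pos_of_lt_slots {b : ℕ} (hb : b < I.k * I.k) : 0 < I.k := by
  rcases Nat.eq_zero_or_pos I.k with h | h
  · simp [h] at hb
  · exact h

theorem row_col_lt {i j : ℕ} (hi : i < I.k) (hj : j < I.k) : i * I.k + j < I.k * I.k := by
  calc i * I.k + j < i * I.k + I.k := by omega
    _ = (i + 1) * I.k := by ring
    _ ≤ I.k * I.k := Nat.mul_le_mul_right _ hi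

theorem row_eq {i j : ℕ} (hj : j < I.k) : (i * I.k + j) / I.k = i := by
  rw [Nat.mul_comm, Nat.mul_add_div (Nat.zero_lt_of_lt hj), Nat.div_eq_of_lt hj, Nat.add_zero]

theorem col_eq {i j : ℕ} (hj : j < I.k) : (i * I.k + j) % I.k = j := by
  rw [Nat.mul_comm, Nat.mul_add_mod, Nat.mod_eq_of_lt hj]

theorem row_lt {b : ℕ} (hb : b < I.k * I.k) : b / I.k < I.k := Nat.div_lt_of_lt_mul hb

theorem center_lt {b : ℕ} (hb : b < I.k * I.k) : I.center b < I.k * I.k :=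
  row_col_lt (row_lt hb) (row_lt hb)

theorem center_div {b : ℕ} (hb : b < I.k * I.k) : I.center b / I.k = b / I.k :=
  row_eq (row_lt hb)

theorem center_mod {b : ℕ} (hb : b < I.k * I.k) : I.center b % I.k = b / I.k :=
  col_eq (row_lt hb)

/-- The vertices in the slots are colored by column. A vertex may fill several slots, but all of
them lie in one column because compatible slots of different columns hold different vertices. -/
theorem IsSolution.hasWitness {x : ℕ → ℕ} (h : I.IsSolution R x) : I.HasWitness R := by
  have hcol : ∀ b < I.k * I.k, ∀ b' < I.k * I.k, x b = x b' → b % I.k = b' % I.k :=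
    fun b hb b' hb' he => by
      by_contra hne
      exact ((h b hb).2 b' hb').2.1 hne he
  let S : Set (Fin I.n) := {v | ∃ b < I.k * I.k, x b = v}
  choose slotOf hslot hx using fun v : S => v.2
  have hc : ∀ (v : S) (b : ℕ), b < I.k * I.k → x b = v → slotOf v % I.k = b % I.k :=
    fun v b hb he => hcol _ (hslot v) _ hb ((hx v).trans he.symm)
  let c : (I.G.induce S).Coloring (Fin I.k) := SimpleGraph.Coloring.mk
    (fun v => ⟨slotOf v % I.k, Nat.mod_lt _ (pos_of_lt_slots (hslot v))⟩) (by
      intro v w hvw he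
      have h₁ := ((h _ (hslot v)).2 _ (hslot w)).1 (Fin.val_eq_of_eq he)
      rw [hx, hx] at h₁
      exact h₁ ⟨v.1.2, w.1.2, hvw⟩)
  have hcv : ∀ (v : S) (i j : Fin I.k), x (i * I.k + j) = v → c v = j := fun v i j he =>
    Fin.ext ((hc v _ (row_col_lt i.2 j.2) he).trans (col_eq j.2))
  refine ⟨S, c, fun i => ?_⟩
  have hi := row_col_lt i.2 i.2
  refine ⟨⟨⟨x (i * I.k + i), (h _ hi).1⟩, _, hi, rfl⟩, hcv _ i i rfl, fun j hR => ?_⟩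
  have hj := row_col_lt i.2 j.2
  refine ⟨⟨⟨x (i * I.k + j), (h _ hj).1⟩, _, hj, rfl⟩, ?_, hcv _ i j rfl⟩
  obtain ⟨_, _, hadj⟩ := ((h _ hi).2 _ hj).2.2 (by rw [center, row_eq j.2])
    (by rwa [row_eq j.2, col_eq j.2])
  exact hadj

/-- Slots `(i, j)` without `R i j` carry no adjacency condition and are filled with the
distinguished vertex of class `j`. Irreflexivity of `R` ensures that the diagonal slot receives the
distinguished vertex of its own class. -/
theorem HasWitness.exists_isSolution (hR : ∀ i, ¬R i i) (h : I.HasWitness R) :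
    ∃ x, I.IsSolution R x := by
  classical
  obtain ⟨S, c, hc⟩ := h
  choose v hv w hw using hc
  obtain ⟨y, hy, hyR⟩ : ∃ y : Fin I.k → Fin I.k → S, (∀ i j, c (y i j) = j) ∧
      ∀ i j : Fin I.k, R i j → (I.G.induce S).Adj (y i i) (y i j) := by
    refine ⟨fun i j => if h : R i j then w i j h else v j, fun i j => ?_, fun i j h => ?_⟩
    · dsimp only
      split_ifs with h
      · exact (hw i j h).2
      · exact hv j
    · simp only [hR, h, dif_pos, dif_neg, not_false_eq_true]
      exact (hw i j h).1
  have hmod : ∀ {b}, b < I.k * I.k → b % I.k < I.k := fun hb => Nat.mod_lt _ (pos_of_lt_slots hb)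
  let x : ℕ → ℕ := fun b => if hb : b < I.k * I.k then
    ((y ⟨b / I.k, row_lt hb⟩ ⟨b % I.k, hmod hb⟩ : Fin I.n) : ℕ) else 0
  have hx : ∀ {b} (hb : b < I.k * I.k),
      x b = (y ⟨b / I.k, row_lt hb⟩ ⟨b % I.k, hmod hb⟩ : Fin I.n) := fun hb => dif_pos hb
  refine ⟨x, fun b hb => ⟨by rw [hx hb]; exact Fin.is_lt _, fun b' hb' => ⟨?_, ?_, ?_⟩⟩⟩
  · rintro hcol ⟨_, _, hadj⟩
    simp only [hx hb, hx hb', Fin.eta] at hadj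
    refine c.valid (v := y ⟨b / I.k, row_lt hb⟩ ⟨b % I.k, hmod hb⟩)
      (w := y ⟨b' / I.k, row_lt hb'⟩ ⟨b' % I.k, hmod hb'⟩) hadj ?_
    rw [hy, hy]
    exact Fin.ext hcol
  · intro hcol he
    rw [hx hb, hx hb'] at he
    have := congrArg c (Subtype.ext (Fin.ext he))
    rw [hy, hy] at this
    exact hcol (Fin.val_eq_of_eq this)
  · rintro rfl hRb
    have := hyR ⟨b' / I.k, row_lt hb'⟩ ⟨b' % I.k, hmod hb'⟩ hRb
    refine ⟨by rw [hx hb]; exact Fin.is_lt _, by rw [hx hb']; exact Fin.is_lt _, ?_⟩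
    simp only [hx hb, hx hb', Fin.eta, center_div hb', center_mod hb']
    exact this

open Classical in
theorem deg_eq_degree (v : Fin I.n) : I.deg v = I.G.degree v := by
  rw [deg, cnt_eq_card, ← SimpleGraph.card_neighborFinset_eq_degree]
  symm
  apply Finset.card_bij (fun (w : Fin I.n) _ => (w : ℕ))
  · intro w hw
    simp only [Finset.mem_filter, Finset.mem_range]
    exact ⟨w.2, v.2, w.2, by simpa using hw⟩
  · intro w _ w' _ h
    exact Fin.ext h
  · intro w hw
    obtain ⟨_, hw, hadj⟩ := (Finset.mem_filter.1 hw).2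
    exact ⟨⟨w, hw⟩, by simpa using hadj, rfl⟩

theorem cnt_high_le (h : I.G.AlmostBoundedDegree I.d I.s) :
    cnt (fun v => I.d < I.deg v) I.n ≤ I.s := by
  classical
  refine le_trans ?_ h
  rw [cnt_eq_card, Set.ncard_eq_toFinset_card', ← Finset.card_map Fin.valEmbedding]
  refine Finset.card_le_card fun v hv => ?_
  obtain ⟨hv, hd⟩ := Finset.mem_filter.1 hv
  refine Finset.mem_map.2 ⟨⟨v, Finset.mem_range.1 hv⟩, ?_, rfl⟩
  rw [Set.mem_toFinset, Set.mem_ofPred_eq]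
  convert hd using 1
  exact (deg_eq_degree ⟨v, Finset.mem_range.1 hv⟩).symm

end GraphInstance

/-! ### Completeness of the search. -/

namespace GraphInstance

open RAM

variable {I : GraphInstance} {R : ℕ → ℕ → Prop} {μ x₀ : ℕ → ℕ}

/-- The modes `μ` describe how the solution `x₀` is built from its roots. -/
def Describes (I : GraphInstance) (R : ℕ → ℕ → Prop) (μ x₀ : ℕ → ℕ) : Prop :=
  ∀ b < I.k * I.k,
    (μ b < I.s ∧ I.hub (μ b) = x₀ b) ∨
    (I.deg (x₀ b) ≤ I.d ∧ I.s ≤ μ b ∧ μ b < I.s + I.d ∧ I.center b ≠ b ∧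
      μ (I.center b) = I.s + I.d ∧ I.nbr (x₀ (I.center b)) (μ b - I.s) = x₀ b) ∨
    (I.deg (x₀ b) ≤ I.d ∧ μ b = I.s + I.d ∧
      (R (b / I.k) (b % I.k) → μ (I.center b) < I.s))

/-- A vertex of high degree is recorded by its rank among the hubs. A vertex of low degree that must
be adjacent to a center of low degree is recorded by its rank among the at most `d` neighbors of
that center. All other slots are free, including, by irreflexivity, every center of low degree. -/
theorem IsSolution.exists_describes (hR : ∀ i, ¬R i i) (hs : I.G.AlmostBoundedDegree I.d I.s)
    (hx : I.IsSolution R x₀) :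
    ∃ μ : ℕ → ℕ, (∀ b < I.k * I.k, μ b < I.modes) ∧ I.Describes R μ x₀ := by
  classical
  let μ : ℕ → ℕ := fun b =>
    if I.d < I.deg (x₀ b) then cnt (fun v => I.d < I.deg v) (x₀ b)
    else if I.deg (x₀ (I.center b)) ≤ I.d ∧ R (b / I.k) (b % I.k) then
      I.s + cnt (I.adj (x₀ (I.center b))) (x₀ b)
    else I.s + I.d
  have hμ : ∀ b, μ b = if I.d < I.deg (x₀ b) then cnt (fun v => I.d < I.deg v) (x₀ b)
    else if I.deg (x₀ (I.center b)) ≤ I.d ∧ R (b / I.k) (b % I.k) then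
      I.s + cnt (I.adj (x₀ (I.center b))) (x₀ b)
    else I.s + I.d := fun _ => rfl
  have hhigh : ∀ b < I.k * I.k, I.d < I.deg (x₀ b) → μ b < I.s ∧ I.hub (μ b) = x₀ b := by
    intro b hb h
    rw [hμ, if_pos h]
    exact ⟨(cnt_lt_cnt (P := fun v => I.d < I.deg v) h (hx b hb).1).trans_le (cnt_high_le hs),
      select_cnt (P := fun v => I.d < I.deg v) h (hx b hb).1⟩
  have key : I.Describes R μ x₀ := by
    intro b hb
    by_cases h₁ : I.d < I.deg (x₀ b)
    · exact Or.inl (hhigh b hb h₁)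
    have hc := center_lt hb
    by_cases h₂ : I.deg (x₀ (I.center b)) ≤ I.d ∧ R (b / I.k) (b % I.k)
    · have hadj := ((hx _ hc).2 b hb).2.2 rfl h₂.2
      have hrank := cnt_lt_cnt hadj (hx b hb).1
      have hdeg : I.deg (x₀ (I.center b)) = cnt (I.adj (x₀ (I.center b))) I.n := rfl
      have hμb : μ b = I.s + cnt (I.adj (x₀ (I.center b))) (x₀ b) := by
        rw [hμ, if_neg h₁, if_pos h₂]
      refine Or.inr (Or.inl ⟨not_lt.1 h₁, by omega, by omega, fun h => ?_, ?_, ?_⟩)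
      · refine hR (b / I.k) ?_
        have h₃ := center_mod hb
        rw [h] at h₃
        simpa [h₃] using h₂.2
      · rw [hμ, if_neg (not_lt.2 h₂.1), if_neg]
        rw [center_div hb, center_mod hb]
        exact fun h => hR _ h.2
      · rw [hμb, Nat.add_sub_cancel_left]
        exact select_cnt hadj (hx b hb).1
    · refine Or.inr (Or.inr ⟨not_lt.1 h₁, by rw [hμ, if_neg h₁, if_neg h₂], fun h => ?_⟩)
      refine (hhigh _ hc ?_).1
      by_contra h₃
      exact h₂ ⟨not_lt.1 h₃, h⟩
  refine ⟨μ, fun b hb => ?_, key⟩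
  unfold modes
  rcases key b hb with h | h | h <;> omega

theorem Describes.hub_eq (hμ : I.Describes R μ x₀) {b : ℕ} (hb : b < I.k * I.k)
    (h : μ b < I.s) : I.hub (μ b) = x₀ b := by
  rcases hμ b hb with h' | h' | h'
  · exact h'.2
  · omega
  · omega

theorem Describes.deg_le (hμ : I.Describes R μ x₀) {b : ℕ} (hb : b < I.k * I.k)
    (h : ¬μ b < I.s) : I.deg (x₀ b) ≤ I.d := by
  rcases hμ b hb with h' | h' | h'
  · exact absurd h'.1 h
  · exact h'.1
  · exact h'.1

theorem root_of_free {b : ℕ} (h : μ b = I.s + I.d) : I.root μ b = b := if_neg (by omega)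

theorem Describes.root_lt (hμ : I.Describes R μ x₀) {b : ℕ} (hb : b < I.k * I.k)
    (h : ¬μ b < I.s) : I.root μ b < I.k * I.k ∧ μ (I.root μ b) = I.s + I.d := by
  rcases hμ b hb with h' | h' | h'
  · exact absurd h'.1 h
  · rw [root, if_pos ⟨h'.2.1, h'.2.2.1⟩]
    exact ⟨center_lt hb, h'.2.2.2.2.1⟩
  · rw [root_of_free h'.2.1]
    exact ⟨hb, h'.2.1⟩

theorem val_hub {a v b : ℕ} (h : μ b < I.s) : I.val μ a v b = I.hub (μ b) := if_pos h

theorem val_self {a v : ℕ} (h : ¬μ a < I.s) : I.val μ a v a = v := by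
  rw [val, if_neg h, if_pos rfl]

theorem Describes.val_eq (hμ : I.Describes R μ x₀) {a b : ℕ} (hb : b < I.k * I.k)
    (h : I.active μ a b) : I.val μ a (x₀ a) b = x₀ b := by
  by_cases hX : μ b < I.s
  · rw [val_hub hX, hμ.hub_eq hb hX]
  have hr := h.resolve_left hX
  rcases hμ b hb with h' | h' | h'
  · exact absurd h'.1 hX
  · rw [root, if_pos ⟨h'.2.1, h'.2.2.1⟩] at hr
    subst hr
    rw [val, if_neg hX, if_neg h'.2.2.2.1.symm]
    exact h'.2.2.2.2.2
  · rw [root_of_free h'.2.1] at hr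
    subst hr
    exact val_self hX

theorem Describes.valid (hμ : I.Describes R μ x₀) (hx : I.IsSolution R x₀) (a : ℕ) :
    I.valid R μ a (x₀ a) := by
  intro b hb hact
  rw [hμ.val_eq hb hact]
  refine ⟨(hx b hb).1, ?_, fun b' hb' hact' => ?_⟩
  · by_cases hX : μ b < I.s
    · exact Or.inl hX
    · exact Or.inr (hμ.deg_le hb hX)
  · have := (hx b hb).2 b' hb'
    rwa [hμ.val_eq hb' hact']

/-- The vertices in the slots of one root are compatible with those in the slots of another
root. -/
def Independent (I : GraphInstance) (R : ℕ → ℕ → Prop) (μ : ℕ → ℕ) (a v a' v' : ℕ) : Prop :=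
  ∀ b < I.k * I.k, ∀ b' < I.k * I.k, ¬μ b < I.s → I.root μ b = a → ¬μ b' < I.s →
    I.root μ b' = a' → I.compat R b b' (I.val μ a v b) (I.val μ a' v' b') ∧
      I.compat R b' b (I.val μ a' v' b') (I.val μ a v b)

theorem Independent.symm {a v a' v' : ℕ} (h : I.Independent R μ a v a' v') :
    I.Independent R μ a' v' a v :=
  fun b hb b' hb' h₁ h₂ h₃ h₄ => (h b' hb' b hb h₃ h₄ h₁ h₂).symm

open Classical in
/-- The closed neighborhood of a vertex. -/
noncomputable def closedNbhd (I : GraphInstance) (v : ℕ) : Finset ℕ :=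
  insert v ((Finset.range I.n).filter (I.adj v))

theorem mem_closedNbhd {v w : ℕ} : w ∈ I.closedNbhd v ↔ w = v ∨ I.adj v w := by
  simp only [closedNbhd, Finset.mem_insert, Finset.mem_filter, Finset.mem_range]
  exact or_congr_right ⟨And.right, fun h => ⟨h.2.1, h⟩⟩

theorem mem_closedNbhd_comm {v w : ℕ} (h : w ∈ I.closedNbhd v) : v ∈ I.closedNbhd w :=
  mem_closedNbhd.2 ((mem_closedNbhd.1 h).imp Eq.symm adj_symm)

theorem card_closedNbhd_le {v : ℕ} (h : I.deg v ≤ I.d) : (I.closedNbhd v).card ≤ I.d + 1 := by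
  classical
  refine (Finset.card_insert_le _ _).trans (Nat.succ_le_succ ?_)
  rwa [← cnt_eq_card]

open Classical in
/-- The vertices that are joined to `v` by a walk of length at most three whose inner vertices
have degree at most `d`. -/
noncomputable def near (I : GraphInstance) (v : ℕ) : Finset ℕ :=
  ((I.closedNbhd v).filter fun y => I.deg y ≤ I.d).biUnion fun y =>
    ((I.closedNbhd y).filter fun z => I.deg z ≤ I.d).biUnion I.closedNbhd

theorem card_near_le {v : ℕ} (h : I.deg v ≤ I.d) :
    (I.near v).card ≤ (I.d + 1) * (I.d + 1) * (I.d + 1) := by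
  classical
  have step : ∀ (u : ℕ) (g : ℕ → Finset ℕ) (m : ℕ), I.deg u ≤ I.d →
      (∀ y, I.deg y ≤ I.d → (g y).card ≤ m) →
      (((I.closedNbhd u).filter fun y => I.deg y ≤ I.d).biUnion g).card ≤ (I.d + 1) * m := by
    intro u g m hu hg
    refine (Finset.card_biUnion_le_card_mul _ _ m fun y hy => hg y (Finset.mem_filter.1 hy).2).trans
      (Nat.mul_le_mul_right _ ((Finset.card_filter_le _ _).trans (card_closedNbhd_le hu)))
  rw [mul_assoc]
  exact step v _ _ h fun y hy => step y _ _ hy fun z hz => card_closedNbhd_le hz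

theorem val_mem_closedNbhd {a v b : ℕ} (h : ¬μ b < I.s) (hn : I.val μ a v b < I.n) :
    I.val μ a v b ∈ I.closedNbhd v := by
  rw [mem_closedNbhd]
  rw [val, if_neg h] at hn ⊢
  split_ifs at hn ⊢ with hb
  · exact Or.inl rfl
  · exact Or.inr (select_prop hn)

/-- Nonadjacent distinct vertices can only violate a required adjacency between a center `b` and a
slot `b'` of its row. If `b'` is derived from its center, both slots have the same root; if `b'` is
free, `Describes` forces the center to be a hub. Both are excluded. -/
theorem Describes.compat_of_far (hμ : I.Describes R μ x₀) {b b' u u' : ℕ} (hb' : b' < I.k * I.k)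
    (h : ¬μ b < I.s) (h' : ¬μ b' < I.s) (hr : I.root μ b ≠ I.root μ b')
    (hu : u ∉ I.closedNbhd u') : I.compat R b b' u u' := by
  rw [mem_closedNbhd, not_or] at hu
  refine ⟨fun _ hadj => hu.2 (adj_symm hadj), fun _ => hu.1, fun hc hRb => absurd ?_ hr⟩
  rcases hμ b' hb' with h₁ | h₁ | h₁
  · exact absurd h₁.1 h'
  · have h₂ : I.root μ b' = I.center b' := if_pos ⟨h₁.2.1, h₁.2.2.1⟩
    rw [h₂, hc, root_of_free h₁.2.2.2.2.1]
  · exact absurd (h₁.2.2 hRb) (hc ▸ h)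

/-- An incompatible pair of slots holds equal or adjacent vertices, and each of these equals or is
adjacent to its root. This gives a walk from `v'` to `v` of length at most three, whose inner
vertices have low degree by validity. -/
theorem Describes.mem_near (hμ : I.Describes R μ x₀) {a v a' v' : ℕ} (hne : a ≠ a')
    (hv : I.valid R μ a v) (hv' : I.valid R μ a' v') (h : ¬I.Independent R μ a v a' v') :
    v ∈ I.near v' := by
  classical
  by_contra hnear
  refine h fun b hb b' hb' h₁ h₂ h₃ h₄ => ?_
  obtain ⟨hn, hd, -⟩ := hv b hb (Or.inr h₂)
  obtain ⟨hn', hd', -⟩ := hv' b' hb' (Or.inr h₄)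
  have hfar : I.val μ a v b ∉ I.closedNbhd (I.val μ a' v' b') := by
    intro hmem
    apply hnear
    simp only [near, Finset.mem_biUnion, Finset.mem_filter]
    exact ⟨_, ⟨val_mem_closedNbhd h₃ hn', hd'.resolve_left h₃⟩, _, ⟨hmem, hd.resolve_left h₁⟩,
      mem_closedNbhd_comm (val_mem_closedNbhd h₁ hn)⟩
  have hr : I.root μ b ≠ I.root μ b' := by rwa [h₂, h₄]
  exact ⟨hμ.compat_of_far hb' h₁ h₃ hr hfar,
    hμ.compat_of_far hb h₃ h₁ hr.symm fun h => hfar (mem_closedNbhd_comm h)⟩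

/-- There are roots among the first candidates that are valid and pairwise independent. -/
theorem Describes.exists_roots (hμ : I.Describes R μ x₀) (hx : I.IsSolution R x₀) :
    ∃ v : ℕ → ℕ, ∀ a < I.k * I.k, μ a = I.s + I.d → v a < I.n ∧ I.valid R μ a (v a) ∧
      cnt (I.valid R μ a) (v a) < I.ranks ∧ ∀ a' < I.k * I.k, μ a' = I.s + I.d → a ≠ a' →
        I.Independent R μ a (v a) a' (v a') := by
  classical
  let A := (Finset.range (I.k * I.k)).filter fun a => μ a = I.s + I.d
  let L := fun a => (Finset.range I.n).filter fun v =>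
    I.valid R μ a v ∧ cnt (I.valid R μ a) v < I.ranks
  have hA : ∀ {a}, a ∈ A ↔ a < I.k * I.k ∧ μ a = I.s + I.d := by simp [A]
  obtain ⟨v, hv⟩ := exists_choice A L (I.valid R μ) (I.Independent R μ)
    ((I.d + 1) * (I.d + 1) * (I.d + 1)) (fun _ _ _ _ => Independent.symm)
    (fun a _ v hv => (Finset.mem_filter.1 hv).2.1)
    (fun a _ a' ha' hne v' hv' => by
      -- A free slot is active for itself, so validity bounds the degree of the root `v'`, as the
      -- bound on `near` requires.
      have hd := hv' a' (hA.1 ha').1 (Or.inr (root_of_free (hA.1 ha').2))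
      have hX : ¬μ a' < I.s := by have := (hA.1 ha').2; omega
      rw [val_self hX] at hd
      refine (Finset.card_le_card fun v hv => ?_).trans (card_near_le (hd.2.1.resolve_left hX))
      obtain ⟨hvL, hv⟩ := Finset.mem_filter.1 hv
      exact hμ.mem_near hne (Finset.mem_filter.1 hvL).2.1 hv' hv)
    x₀ (fun a _ => hμ.valid hx a)
    (fun a _ a' _ _ b hb b' hb' _ h₂ _ h₄ => by
      rw [hμ.val_eq hb (Or.inr h₂), hμ.val_eq hb' (Or.inr h₄)]
      exact ⟨(hx b hb).2 b' hb', (hx b' hb').2 b hb⟩)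
    (fun a ha => by
      have hn := (hx a (hA.1 ha).1).1
      by_cases h : cnt (I.valid R μ a) (x₀ a) < I.ranks
      · exact Or.inl (Finset.mem_filter.2 ⟨Finset.mem_range.2 hn, hμ.valid hx a, h⟩)
      -- If the root in `x₀` has rank at least `ranks`, there are that many candidates before it.
      -- The summand 1 in `ranks` makes their number exceed `A.card * D`.
      · right
        have hle : I.ranks ≤ cnt (I.valid R μ a) I.n := (not_lt.1 h).trans (cnt_mono hn.le)
        rw [card_first, min_eq_left hle]
        have hcard : A.card ≤ I.k * I.k := (Finset.card_filter_le _ _).trans (by simp)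
        exact Nat.lt_succ_of_le (Nat.mul_le_mul_right _ hcard))
  refine ⟨v, fun a ha hf => ?_⟩
  obtain ⟨hvL, hind⟩ := hv a (hA.2 ⟨ha, hf⟩)
  obtain ⟨hn, hval, hcnt⟩ := Finset.mem_filter.1 hvL
  exact ⟨Finset.mem_range.1 hn, hval, hcnt, fun a' ha' hf' => hind a' (hA.2 ⟨ha', hf'⟩)⟩

/-- Two hubs are compatible as in `x₀`, where they are unchanged. A hub and a dependent slot, or two
slots with the same root, are compatible by validity, and slots with different roots by
independence. -/
theorem Describes.isSolution_slot (hμ : I.Describes R μ x₀) (hx : I.IsSolution R x₀)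
    {τ v : ℕ → ℕ} (hτ : ∀ a < I.k * I.k, μ a = I.s + I.d → τ a = cnt (I.valid R μ a) (v a))
    (hv : ∀ a < I.k * I.k, μ a = I.s + I.d → v a < I.n ∧ I.valid R μ a (v a) ∧
      ∀ a' < I.k * I.k, μ a' = I.s + I.d → a ≠ a' → I.Independent R μ a (v a) a' (v a')) :
    I.IsSolution R (I.slot R μ τ) := by
  have hhub : ∀ b < I.k * I.k, μ b < I.s → I.slot R μ τ b = x₀ b := fun b hb h => by
    rw [slot, val_hub h, hμ.hub_eq hb h]
  have hslot : ∀ b < I.k * I.k, ¬μ b < I.s →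
      I.slot R μ τ b = I.val μ (I.root μ b) (v (I.root μ b)) b := fun b hb h => by
    obtain ⟨ha, hf⟩ := hμ.root_lt hb h
    obtain ⟨hn, hval, -⟩ := hv _ ha hf
    rw [slot, hτ _ ha hf, select_cnt hval hn]
  have hval : ∀ b < I.k * I.k, ∀ a, μ b < I.s → I.val μ a (v a) b = x₀ b := fun b hb a h => by
    rw [val_hub h, hμ.hub_eq hb h]
  intro b hb
  by_cases h : μ b < I.s
  · rw [hhub b hb h]
    refine ⟨(hx b hb).1, fun b' hb' => ?_⟩
    by_cases h' : μ b' < I.s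
    · rw [hhub b' hb' h']
      exact (hx b hb).2 b' hb'
    · obtain ⟨ha, hf⟩ := hμ.root_lt hb' h'
      have := ((hv _ ha hf).2.1 b hb (Or.inl h)).2.2 b' hb' (Or.inr rfl)
      rwa [hval b hb _ h, ← hslot b' hb' h'] at this
  · obtain ⟨ha, hf⟩ := hμ.root_lt hb h
    obtain ⟨hn, -, hc⟩ := (hv _ ha hf).2.1 b hb (Or.inr rfl)
    rw [hslot b hb h]
    refine ⟨hn, fun b' hb' => ?_⟩
    by_cases h' : μ b' < I.s
    · have := hc b' hb' (Or.inl h')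
      rwa [hval b' hb' _ h', ← hhub b' hb' h'] at this
    · rw [hslot b' hb' h']
      obtain ⟨ha', hf'⟩ := hμ.root_lt hb' h'
      by_cases hr : I.root μ b = I.root μ b'
      · rw [← hr]
        exact hc b' hb' (Or.inr hr.symm)
      · exact ((hv _ ha hf).2.2 _ ha' hf' hr b hb b' hb' h rfl h' rfl).1

theorem digit_of_lt {B c b : ℕ} (hb : b < I.k * I.k) : I.digit B c b = c / B ^ b % B := by
  rw [digit, min_eq_left hb.le]

theorem Describes.congr {μ' : ℕ → ℕ} (hμ : I.Describes R μ x₀)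
    (h : ∀ b < I.k * I.k, μ' b = μ b) : I.Describes R μ' x₀ := fun b hb => by
  rw [h b hb, h _ (center_lt hb)]
  exact hμ b hb

theorem IsSolution.accepts (hR : ∀ i, ¬R i i) (hs : I.G.AlmostBoundedDegree I.d I.s)
    (hx : I.IsSolution R x₀) : I.Accepts R := by
  classical
  obtain ⟨μ, hμm, hμ⟩ := hx.exists_describes hR hs
  obtain ⟨c, hc, hcμ⟩ := exists_digits I.modes (I.k * I.k) μ hμm
  have hμ' : I.Describes R (I.digit I.modes c) x₀ :=
    hμ.congr fun b hb => (digit_of_lt hb).trans (hcμ b hb)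
  generalize hμc : I.digit I.modes c = μc at hμ'
  obtain ⟨v, hv⟩ := hμ'.exists_roots hx
  -- Only the ranks of free slots matter; the others are set to 0 to be legal digits.
  obtain ⟨e, he, heτ⟩ := exists_digits I.ranks (I.k * I.k)
    (fun a => if μc a = I.s + I.d then cnt (I.valid R μc a) (v a) else 0) (fun a ha => by
      split_ifs with h
      · exact (hv a ha h).2.2.1
      · exact Nat.succ_pos _)
  refine ⟨c, hc, e, he, ?_⟩
  rw [hμc]
  refine hμ'.isSolution_slot hx (v := v) (fun a ha hf => ?_) fun a ha hf => ?_
  · rw [digit_of_lt ha, heτ a ha, if_pos hf]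
  · obtain ⟨h₁, h₂, -, h₃⟩ := hv a ha hf
    exact ⟨h₁, h₂, h₃⟩

theorem accepts_iff_hasWitness (hR : ∀ i, ¬R i i) (hs : I.G.AlmostBoundedDegree I.d I.s) :
    I.Accepts R ↔ I.HasWitness R := by
  constructor
  · rintro ⟨_, _, _, _, h⟩
    exact h.hasWitness
  · intro h
    obtain ⟨x, hx⟩ := h.exists_isSolution hR
    exact hx.accepts hR hs

theorem decidableInFPTTime_hasWitness (hR : ∀ i, ¬R i i) (hRc : CompRel R) :
    DecidableInFPTTime (fun I => 0 < I.k ∧ I.G.AlmostBoundedDegree I.d I.s)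
      (fun I => I.k + I.d + I.s) (fun I => I.HasWitness R) := by
  have h : DecidableInFPTTime (fun I => 0 < I.k ∧ I.G.AlmostBoundedDegree I.d I.s)
      (fun I => I.k + I.d + I.s) (fun I => I.Accepts R) :=
    decidableInFPTTime_of_compP (CompP.accepts (C := Ctx.base) hRc)
  obtain ⟨p, f, c, hf, h⟩ := h
  refine ⟨p, f, c, hf, fun I hI => ?_⟩
  obtain ⟨t, τ, h₁, h₂, h₃⟩ := h I hI
  refine ⟨t, τ, h₁, h₂, ?_⟩
  rw [h₃]
  have hiff : I.Accepts R ↔ I.HasWitness R := accepts_iff_hasWitness hR hI.2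
  by_cases hw : I.HasWitness R
  · exact (if_pos (hiff.2 hw)).trans (if_pos hw).symm
  · exact (if_neg (mt hiff.1 hw)).trans (if_neg hw).symm

end GraphInstance

theorem mainTheorem3 :
    DecidableInFPTTime (fun I => 0 < I.k ∧ I.G.AlmostBoundedDegree I.d I.s)
      (fun I => I.k + I.d + I.s)
      (fun I => ∃ S : Set (Fin I.n), I.G.IsBChromaticCore I.k S) ∧
    DecidableInFPTTime (fun I => 0 < I.k ∧ I.G.AlmostBoundedDegree I.d I.s)
      (fun I => I.k + I.d + I.s)
      (fun I => ∃ S : Set (Fin I.n), I.G.IsPartialGrundyWitness I.k S) := by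
  constructor
  -- The colors are compared in `Fin k` on one side and as natural numbers on the other. For `<` the
  -- two agree by definition.
  · convert GraphInstance.decidableInFPTTime_hasWitness (R := fun i j => ¬j = i)
      (fun i h => h rfl) (fun _ _ _ ha hb => (RAM.CompP.eq hb ha).not) using 2
    simp only [SimpleGraph.IsBChromaticCore, SimpleGraph.IsBColoring, GraphInstance.HasWitness,
      ne_eq, Fin.ext_iff]
  · exact GraphInstance.decidableInFPTTime_hasWitness (R := fun i j => j < i)
      (fun i => lt_irrefl i) (fun _ _ _ ha hb => RAM.CompP.lt hb ha)
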